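/- Let $\mathcal L$ be the twisted Heisenberg–Virasoro algebra: the complex Lie algebra with basis $L(m), I(m)$ ($m\in\mathbb Z$), $C_L, C_I, C_{LI}$ and brackets $$[L(m),L(n)]=(n-m)L(m+n)+\delta_{m+n,0}\tfrac{m^3-m}{12}C_L,\qquad [I(m),I(n)]=n\,\delta_{m+n,0}C_I,$$ $$[L(m),I(n)]=n\,I(m+n)+\delta_{m+n,0}(m^2-m)C_{LI},$$ with $C_L, C_I, C_{LI}$ central. It is $\mathbb Z$-graded: $\mathcal L_m$ is spanned by $L(m), I(m)$ and, if $m=0$, also by $C_L, C_I, C_{LI}$. **Theorem.** Let $V$ be an indecomposable $\mathcal L$-module (nonzero, and not a direct sum of two nonzero submodules) with a $\mathbb C$-basis $(v_m)_{m\in\mathbb Z}$ such that $\mathcal L_m v_n\subset\mathbb C v_{m+n}$ for all $m,n\in\mathbb Z$. Then $V$ is isomorphic, as an $\mathcal L$-module, to one of the following modules for suitable $a,b,c,d\in\mathbb C$. Each of them has basis $(v_t)_{t\in\mathbb Z}$, the elements $C_L, C_I, C_{LI}$ act on it by $0$, and for all $n,t\in\mathbb Z$: 1. $\mathcal A_{a,b,c}$: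 $L(n)v_t=(a+t+bn)v_{n+t}$, $\ I(n)v_t=c\,v_{n+t}$; 2. $\mathcal A(a,d)$: $L(n)v_t=(t+n)v_{n+t}$ if $t\neq0$, $L(n)v_0=n(n+a)v_n$, $\ I(n)v_t=0$ if $t\ne0$, $I(n)v_0=dn\,v_n$; 3. $\mathcal B(a,d)$: $L(n)v_t=t\,v_{n+t}$ if $n+t\neq0$, $L(n)v_{-n}=-n(n+a)v_0$, $\ I(n)v_t=0$ if $n+t\ne0$, $I(n)v_{-n}=dn\,v_0$; 4. $\mathcal U_d$: $L(n)v_t=t\,v_{n+t}$, $\ I(n)v_t=0$ if $n+t\ne0$, $I(n)v_{-n}=dn\,v_0$; 5. $\mathcal V_d$: $L(n)v_t=(t+n)v_{n+t}$, $\ I(n)v_t=0$ if $t\ne0$, $I(n)v_0=dn\,v_n$; 6. $\tilde{\mathcal U}_d$ with $d\neq0$: $L(n)v_t=t\,v_{n+t}$ if $n+t\ne0$, $L(n)v_{-n}=0$, $\ I(n)v_t=0$ if $n+t\ne0$, $I(n)v_{-n}=dn\,v_0$; 7. $\tilde{\mathcal V}_c$ with $c\neq0$: $L(n)v_t=t\,v_{n+t}$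 if $n+t\ne0$, $L(n)v_{-n}=0$, $\ I(n)v_t=0$ if $t\ne0$ or $n=t=0$, $I(n)v_0=c\,v_n$ if $n\ne0$. In particular $C_L, C_I, C_{LI}$ act on $V$ by zero. -/

import Mathlib

noncomputable section

namespace TwistedHV

/-! ### The twisted Heisenberg–Virasoro algebra -/

/-- Labels of the standard basis `L(m), I(m), C_L, C_I, C_LI`. -/
inductive Gen : Type
  | L (m : ℤ)
  | I (m : ℤ)
  | CL
  | CI
  | CLI

/-- The underlying vector space of the twisted Heisenberg–Virasoro algebra: the free complex
vector space on `L(m), I(m), C_L, C_I, C_LI`. -/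
def HV : Type := Gen →₀ ℂ

instance : AddCommGroup HV := inferInstanceAs (AddCommGroup (Gen →₀ ℂ))
instance : Module ℂ HV := inferInstanceAs (Module ℂ (Gen →₀ ℂ))

/-- The basis vector with a given label. -/
def gen (g : Gen) : HV := Finsupp.single g (1 : ℂ)

/-- The brackets of the basis vectors. -/
def genBracket : Gen → Gen → HV
  | .L m, .L n => ((n : ℂ) - m) • gen (.L (m + n)) +
      if m + n = 0 then (((m : ℂ) ^ 3 - m) / 12) • gen .CL else 0
  | .I m, .I n => if m + n = 0 then (n : ℂ) • gen .CI else 0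
  | .L m, .I n => (n : ℂ) • gen (.I (m + n)) +
      if m + n = 0 then ((m : ℂ) ^ 2 - m) • gen .CLI else 0
  | .I m, .L n => -((m : ℂ) • gen (.I (n + m)) +
      if n + m = 0 then ((n : ℂ) ^ 2 - n) • gen .CLI else 0)
  | _, _ => 0

/-- The linear map on `HV` with prescribed values on the basis. -/
def lift {M : Type*} [AddCommGroup M] [Module ℂ M] (f : Gen → M) : HV →ₗ[ℂ] M :=
  (Finsupp.linearCombination ℂ f : (Gen →₀ ℂ) →ₗ[ℂ] M)

theorem lift_gen {M : Type*} [AddCommGroup M] [Module ℂ M] (f : Gen → M) (g : Gen) :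
    lift f (gen g) = f g :=
  (Finsupp.linearCombination_single ℂ (1 : ℂ) g).trans (one_smul ℂ (f g))

theorem hom_ext {M : Type*} [AddCommGroup M] [Module ℂ M] {f f' : HV →ₗ[ℂ] M}
    (h : ∀ g, f (gen g) = f' (gen g)) : f = f' :=
  Finsupp.lhom_ext' (M := ℂ) (φ := f) (ψ := f') fun g => LinearMap.ext_ring (h g)

theorem gen_induction {p : HV → Prop} (x : HV) (zero : p 0)
    (add : ∀ x y, p x → p y → p (x + y)) (smul : ∀ (c : ℂ) g, p (c • gen g)) : p x := by
  refine Finsupp.induction_linear x zero add fun g c => ?_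
  have h := smul c g
  have e : c • gen g = (Finsupp.single g c : Gen →₀ ℂ) :=
    (Finsupp.smul_single c g (1 : ℂ)).trans (by rw [smul_eq_mul, mul_one])
  rwa [e] at h

/-- The bilinear extension of `genBracket`. -/
def bracketMap : HV →ₗ[ℂ] HV →ₗ[ℂ] HV := lift fun g => lift (genBracket g)

theorem bracketMap_gen (g h : Gen) : bracketMap (gen g) (gen h) = genBracket g h := by
  simp [bracketMap, lift_gen]

theorem bracketMap_skew (x y : HV) : bracketMap x y = -bracketMap y x := by
  have key : bracketMap = -bracketMap.flip := by
    refine hom_ext fun g => hom_ext fun h => ?_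
    simp only [LinearMap.neg_apply, LinearMap.flip_apply, bracketMap_gen]
    rcases g with m | m | _ | _ | _ <;> rcases h with n | n | _ | _ | _ <;>
      simp only [genBracket, neg_zero, neg_neg]
    · rw [add_comm n m]
      split_ifs with h
      · obtain rfl : n = -m := by omega
        push_cast
        module
      · module
    · rw [add_comm n m]
      split_ifs with h
      · obtain rfl : n = -m := by omega
        push_cast
        module
      · simp
  exact congrArg (fun f => f x y) key

theorem bracketMap_jacobi (x y z : HV) :
    bracketMap x (bracketMap y z) =
      bracketMap (bracketMap x y) z + bracketMap y (bracketMap x z) := by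
  have gens : ∀ g h k : Gen, bracketMap (gen g) (genBracket h k) =
      bracketMap (genBracket g h) (gen k) + bracketMap (gen h) (genBracket g k) := by
    intro g h k
    rcases g with m | m | _ | _ | _ <;> rcases h with n | n | _ | _ | _ <;>
      rcases k with p | p | _ | _ | _ <;>
      simp only [genBracket, map_add, map_smul, map_neg, map_zero, LinearMap.add_apply,
        LinearMap.smul_apply, LinearMap.neg_apply, LinearMap.zero_apply, bracketMap_gen,
        apply_ite bracketMap, apply_ite (bracketMap _), add_zero, smul_zero, neg_zero,
        ite_self, DFunLike.ite_apply]
    all_goals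
      simp only [← add_assoc, add_comm n m, add_comm p m, add_comm p n, add_right_comm m p n,
        show n + p + m = m + n + p by ring]
      split_ifs with h
      · obtain rfl : p = -m - n := by omega
        push_cast
        module
      · push_cast
        module
  induction x using gen_induction with
  | zero => simp
  | add x x' hx hx' =>
    simp only [map_add, LinearMap.add_apply, hx, hx']
    abel
  | smul a g =>
    induction y using gen_induction with
    | zero => simp
    | add y y' hy hy' =>
      simp only [map_add, LinearMap.add_apply, hy, hy']
      abel
    | smul b h =>
      induction z using gen_induction with
      | zero => simp
      | add z z' hz hz' =>
        simp only [map_add, hz, hz']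
        abel
      | smul c k =>
        simp only [map_smul, LinearMap.smul_apply, bracketMap_gen, gens g h k]
        module

instance : LieRing HV where
  bracket x y := bracketMap x y
  add_lie x y z := by
    change bracketMap _ _ = bracketMap _ _ + bracketMap _ _
    simp
  lie_add x y z := by
    change bracketMap _ _ = bracketMap _ _ + bracketMap _ _
    simp
  lie_self x := by
    change bracketMap x x = 0
    have h2 : (2 : ℂ) • bracketMap x x = 0 := by
      rw [two_smul]
      nth_rewrite 1 [bracketMap_skew x x]
      exact neg_add_cancel _
    exact (smul_eq_zero.mp h2).resolve_left two_ne_zero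
  leibniz_lie x y z := bracketMap_jacobi x y z

instance : LieAlgebra ℂ HV where
  lie_smul c x y := by
    change bracketMap _ _ = c • bracketMap _ _
    simp

/-- The homogeneous component of degree `m`: it is spanned by `L(m)` and `I(m)`, and, if `m = 0`,
also by the central elements. -/
def component (m : ℤ) : Submodule ℂ HV :=
  Submodule.span ℂ ({gen (.L m), gen (.I m)} ∪
    {x | m = 0 ∧ (x = gen .CL ∨ x = gen .CI ∨ x = gen .CLI)})

/-- A module is indecomposable if it is nonzero and is not the direct sum of two nonzero
submodules. -/
def Indecomposable (V : Type*) [AddCommGroup V] [Module ℂ V] [LieRingModule HV V]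
    [LieModule ℂ HV V] : Prop :=
  Nontrivial V ∧ ∀ W₁ W₂ : LieSubmodule ℂ HV V, IsCompl W₁ W₂ → W₁ = ⊥ ∨ W₂ = ⊥

/-! ### Modules with basis `v_t`, `t ∈ ℤ`, on which the centre acts by zero -/

/-- Coefficients for which `L(n) v_t = l n t • v_{n+t}`, `I(n) v_t = i n t • v_{n+t}`,
`C_L = C_I = C_LI = 0` is a module over the twisted Heisenberg–Virasoro algebra. -/
structure Coeffs where
  l : ℤ → ℤ → ℂ
  i : ℤ → ℤ → ℂ
  hLL : ∀ m n t, l n t * l m (n + t) - l m t * l n (m + t) = ((n : ℂ) - m) * l (m + n) t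
  hLI : ∀ m n t, i n t * l m (n + t) - l m t * i n (m + t) = (n : ℂ) * i (m + n) t
  hII : ∀ m n t, i n t * i m (n + t) = i m t * i n (m + t)

/-- The module with basis `v_t`, `t ∈ ℤ`, given by the coefficients `k`. -/
def Coeffs.Mod (_k : Coeffs) : Type := ℤ →₀ ℂ

instance (k : Coeffs) : AddCommGroup k.Mod := inferInstanceAs (AddCommGroup (ℤ →₀ ℂ))
instance (k : Coeffs) : Module ℂ k.Mod := inferInstanceAs (Module ℂ (ℤ →₀ ℂ))

/-- The basis vector `v_t`. -/
def Coeffs.vec (k : Coeffs) (t : ℤ) : k.Mod := Finsupp.single t (1 : ℂ)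

/-- The linear endomorphism with prescribed values on the basis `v_t`. -/
def Coeffs.lift (k : Coeffs) (f : ℤ → k.Mod) : k.Mod →ₗ[ℂ] k.Mod :=
  (Finsupp.linearCombination ℂ f : (ℤ →₀ ℂ) →ₗ[ℂ] k.Mod)

theorem Coeffs.lift_vec (k : Coeffs) (f : ℤ → k.Mod) (t : ℤ) : k.lift f (k.vec t) = f t :=
  (Finsupp.linearCombination_single ℂ (1 : ℂ) t).trans (one_smul ℂ (f t))

theorem Coeffs.hom_ext (k : Coeffs) {f f' : k.Mod →ₗ[ℂ] k.Mod}
    (h : ∀ t, f (k.vec t) = f' (k.vec t)) : f = f' :=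
  Finsupp.lhom_ext' (M := ℂ) (φ := f) (ψ := f') fun t => LinearMap.ext_ring (h t)

/-- The action of the basis vectors of the algebra. -/
def Coeffs.genAct (k : Coeffs) : Gen → Module.End ℂ k.Mod
  | .L n => k.lift fun t => k.l n t • k.vec (n + t)
  | .I n => k.lift fun t => k.i n t • k.vec (n + t)
  | _ => 0

/-- The action of the algebra. -/
def Coeffs.act (k : Coeffs) : HV →ₗ[ℂ] Module.End ℂ k.Mod := TwistedHV.lift k.genAct

theorem Coeffs.act_gen (k : Coeffs) (g : Gen) : k.act (gen g) = k.genAct g :=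
  TwistedHV.lift_gen _ _

theorem Coeffs.act_bracket (k : Coeffs) (x y : HV) :
    k.act ⁅x, y⁆ = k.act x * k.act y - k.act y * k.act x := by
  change k.act (bracketMap x y) = _
  have gens : ∀ g h : Gen, k.act (genBracket g h) =
      k.genAct g * k.genAct h - k.genAct h * k.genAct g := by
    intro g h
    refine k.hom_ext fun t => ?_
    rcases g with m | m | _ | _ | _ <;> rcases h with n | n | _ | _ | _ <;>
      simp only [genBracket, map_add, map_smul, map_neg, map_zero, LinearMap.add_apply,
        LinearMap.smul_apply, LinearMap.neg_apply, LinearMap.zero_apply, LinearMap.sub_apply,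
        Module.End.mul_apply, Coeffs.act_gen, Coeffs.genAct, Coeffs.lift_vec, smul_smul,
        apply_ite k.act, add_zero, smul_zero, neg_zero, sub_zero, zero_mul, mul_zero, ite_self]
    · rw [add_left_comm n m t, ← sub_smul, add_assoc, k.hLL]
    · rw [add_left_comm n m t, ← sub_smul, add_assoc, k.hLI]
    · rw [add_left_comm n m t, ← sub_smul, ← neg_smul, add_assoc, ← k.hLI]
      congr 1
      · ring
      · rw [add_left_comm]
    · rw [add_left_comm n m t, ← sub_smul, k.hII, sub_self, zero_smul]
  induction x using gen_induction with
  | zero => simp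
  | add x x' hx hx' =>
    simp only [map_add, LinearMap.add_apply, hx, hx', add_mul, mul_add]
    abel
  | smul a g =>
    induction y using gen_induction with
    | zero => simp
    | add y y' hy hy' =>
      simp only [map_add, hy, hy', add_mul, mul_add]
      abel
    | smul b h =>
      simp only [map_smul, LinearMap.smul_apply, bracketMap_gen, gens g h, Coeffs.act_gen,
        smul_mul_assoc, mul_smul_comm, smul_sub, smul_comm a b]

instance (k : Coeffs) : LieRingModule HV k.Mod where
  bracket x v := k.act x v
  add_lie x y v := by
    simp
  lie_add x v w := by
    simp
  leibniz_lie x y v := by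
    change k.act x (k.act y v) = k.act ⁅x, y⁆ v + k.act y (k.act x v)
    simp [k.act_bracket]

instance (k : Coeffs) : LieModule ℂ HV k.Mod where
  smul_lie c x v := by
    change k.act _ _ = c • k.act _ _
    simp
  lie_smul c x v := by
    change k.act _ _ = c • k.act _ _
    simp

/-! ### The seven families -/

theorem cast_rel (m n t : ℤ) : (t = 0 → (t : ℂ) = 0) ∧ (m = 0 → (m : ℂ) = 0) ∧
    (n = 0 → (n : ℂ) = 0) ∧ (n + t = 0 → (n : ℂ) + t = 0) ∧ (m + t = 0 → (m : ℂ) + t = 0) ∧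
    (m + n + t = 0 → (m : ℂ) + n + t = 0) := by
  refine ⟨?_, ?_, ?_, ?_, ?_, ?_⟩ <;> intro h <;> exact_mod_cast h

/-- `𝒜_{a,b,c}`: `L(n) v_t = (a + t + b n) v_{n+t}`, `I(n) v_t = c v_{n+t}`. -/
def modA (a b c : ℂ) : Coeffs where
  l n t := a + t + b * n
  i _ _ := c
  hLL m n t := by push_cast; ring
  hLI m n t := by push_cast; ring
  hII m n t := by ring

/-- `𝒜(a,d)`: `L(n) v_t = (t + n) v_{n+t}` for `t ≠ 0`, `L(n) v_0 = n (n + a) v_n`,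
`I(n) v_t = 0` for `t ≠ 0`, `I(n) v_0 = d n v_n`. -/
def modAd (a d : ℂ) : Coeffs where
  l n t := if t = 0 then n * (n + a) else t + n
  i n t := if t = 0 then d * n else 0
  hLL m n t := by
    split_ifs <;> first
      | omega
      | (push_cast; ring1)
      | (have e := cast_rel m n t; push_cast; grind)
  hLI m n t := by
    split_ifs <;> first
      | omega
      | (push_cast; ring1)
      | (have e := cast_rel m n t; push_cast; grind)
  hII m n t := by
    split_ifs <;> first
      | omega
      | (push_cast; ring1)
      | (have e := cast_rel m n t; push_cast; grind)

/-- `ℬ(a,d)`: `L(n) v_t = t v_{n+t}` for `n + t ≠ 0`, `L(n) v_{-n} = -n (n + a) v_0`,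
`I(n) v_t = 0` for `n + t ≠ 0`, `I(n) v_{-n} = d n v_0`. -/
def modB (a d : ℂ) : Coeffs where
  l n t := if n + t = 0 then -n * (n + a) else t
  i n t := if n + t = 0 then d * n else 0
  hLL m n t := by
    split_ifs <;> first
      | omega
      | (push_cast; ring1)
      | (have e := cast_rel m n t; push_cast; grind)
  hLI m n t := by
    split_ifs <;> first
      | omega
      | (push_cast; ring1)
      | (have e := cast_rel m n t; push_cast; grind)
  hII m n t := by
    split_ifs <;> first
      | omega
      | (push_cast; ring1)
      | (have e := cast_rel m n t; push_cast; grind)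

/-- `𝒰_d`: `L(n) v_t = t v_{n+t}`, `I(n) v_t = 0` for `n + t ≠ 0`, `I(n) v_{-n} = d n v_0`. -/
def modU (d : ℂ) : Coeffs where
  l _ t := t
  i n t := if n + t = 0 then d * n else 0
  hLL m n t := by push_cast; ring
  hLI m n t := by
    split_ifs <;> first
      | omega
      | (push_cast; ring1)
      | (have e := cast_rel m n t; push_cast; grind)
  hII m n t := by
    split_ifs <;> first
      | omega
      | (push_cast; ring1)
      | (have e := cast_rel m n t; push_cast; grind)

/-- `𝒱_d`: `L(n) v_t = (t + n) v_{n+t}`, `I(n) v_t = 0` for `t ≠ 0`, `I(n) v_0 = d n v_n`. -/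
def modV (d : ℂ) : Coeffs where
  l n t := t + n
  i n t := if t = 0 then d * n else 0
  hLL m n t := by push_cast; ring
  hLI m n t := by
    split_ifs <;> first
      | omega
      | (push_cast; ring1)
      | (have e := cast_rel m n t; push_cast; grind)
  hII m n t := by
    split_ifs <;> first
      | omega
      | (push_cast; ring1)
      | (have e := cast_rel m n t; push_cast; grind)

/-- `Ũ_d`: `L(n) v_t = t v_{n+t}` for `n + t ≠ 0`, `L(n) v_{-n} = 0`,
`I(n) v_t = 0` for `n + t ≠ 0`, `I(n) v_{-n} = d n v_0`. -/
def modUtilde (d : ℂ) : Coeffs where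
  l n t := if n + t = 0 then 0 else t
  i n t := if n + t = 0 then d * n else 0
  hLL m n t := by
    split_ifs <;> first
      | omega
      | (push_cast; ring1)
      | (have e := cast_rel m n t; push_cast; grind)
  hLI m n t := by
    split_ifs <;> first
      | omega
      | (push_cast; ring1)
      | (have e := cast_rel m n t; push_cast; grind)
  hII m n t := by
    split_ifs <;> first
      | omega
      | (push_cast; ring1)
      | (have e := cast_rel m n t; push_cast; grind)

/-- `Ṽ_c`: `L(n) v_t = t v_{n+t}` for `n + t ≠ 0`, `L(n) v_{-n} = 0`,
`I(n) v_t = 0` if `t ≠ 0` or `n = t = 0`, `I(n) v_0 = c v_n` for `n ≠ 0`. -/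
def modVtilde (c : ℂ) : Coeffs where
  l n t := if n + t = 0 then 0 else t
  i n t := if t ≠ 0 ∨ (n = 0 ∧ t = 0) then 0 else c
  hLL m n t := by
    split_ifs <;> first
      | omega
      | (push_cast; ring1)
      | (have e := cast_rel m n t; push_cast; grind)
  hLI m n t := by
    split_ifs <;> first
      | omega
      | (push_cast; ring1)
      | (have e := cast_rel m n t; push_cast; grind)
  hII m n t := by
    split_ifs <;> first
      | omega
      | (push_cast; ring1)
      | (have e := cast_rel m n t; push_cast; grind)

end TwistedHV

end

/-!
A graded module with basis `v_x`, `x ∈ ℤ`, is given by the scalars `L x y` and `I x y` through which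
the elements of degree `y - x` send `v_x` to `v_y`; the brackets are relations between the paths
`x → y → z`. Products of these scalars along a loop do not change when the basis is rescaled, and
they determine the module as long as enough of the scalars are nonzero.

The products of the `L x y` along loops of length 2 and 3 through three consecutive degrees depend
polynomially on the degree, with coefficients given by the central charge and a few constants,
among them `β` for the edges and `p` for the triangles. Since the two orientations of a triangle
multiply to the product of its three edges, `C_L` acts by zero and `(β, p)` lies on the nodal cubic
`p² = β² (1 - 4 β)`. A point of this curve comes from a value of `b`, and in large degrees the
module is `𝒜_{a,b,c}` up to rescaling the basis.

The differences between the loop products of the module and those of `𝒜_{a,b,c}` are periodic in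
the degree. They vanish in large degrees, hence in all degrees. So the module is `𝒜_{a,b,c}` on all
degrees `x` that are joined to the large ones, namely on all of `ℤ` unless `b ∈ {0, 1}` and `a` is
an integer, and otherwise on all degrees but one. The ways to attach the last degree give the
exceptional families.
-/

namespace TwistedHV

open Filter

/-! ### Functions of an integer variable -/

theorem exists_const_of_periodic_one {α : Type*} {f : ℤ → α} (hf : Function.Periodic f 1) :
    ∃ r, ∀ t, f t = r :=
  ⟨f 0, fun t => by simpa using hf.int_mul_eq t⟩

theorem forall_of_periodic_of_eventually {α : Type*} {f : ℤ → α} {p : ℤ}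
    (hf : Function.Periodic f p) (hp : p ≠ 0) {P : α → Prop} (h : ∀ᶠ t in atTop, P (f t))
    (t : ℤ) : P (f t) := by
  obtain ⟨T, hT⟩ := eventually_atTop.mp h
  rw [← hf.int_mul (p * |T - t|) t]
  refine hT _ ?_
  have hpp : 1 ≤ p * p := mul_self_pos.mpr hp
  have hle : T - t ≤ |T - t| := le_abs_self _
  simp only [Int.cast_id]
  nlinarith [abs_nonneg (T - t)]

theorem eventually_add_intCast_ne_zero {R : Type*} [Ring R] [CharZero R] (z : R) :
    ∀ᶠ t : ℤ in atTop, z + t ≠ 0 := by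
  have hfin : {t : ℤ | z + t = 0}.Finite := Set.Subsingleton.finite fun s hs t ht =>
    Int.cast_injective (add_left_cancel (hs.trans ht.symm))
  exact (Int.cofinite_eq ▸ le_sup_right : atTop ≤ cofinite) hfin.compl_mem_cofinite

theorem exists_eq_affine {F : Type*} [Field F] [CharZero F] {φ : ℤ → F}
    (h : ∀ n m : ℤ, n ≠ 0 → m ≠ 0 → n + m ≠ 0 →
      n * φ n - m * φ m = ((n : F) - m) * φ (n + m)) :
    ∃ α β : F, ∀ n : ℤ, n ≠ 0 → φ n = α * n + β := by
  refine ⟨φ 2 - φ 1, 2 * φ 1 - φ 2, ?_⟩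
  have of_two_le : ∀ n : ℤ, 2 ≤ n → φ n = (φ 2 - φ 1) * n + (2 * φ 1 - φ 2) := by
    intro n hn
    induction n, hn using Int.leInduction with
    | base => push_cast; ring
    | succ n hn ih =>
      have e := h n 1 (by omega) (by omega) (by omega)
      have hn' : (n : F) - 1 ≠ 0 := sub_ne_zero.mpr (by exact_mod_cast (by omega : n ≠ 1))
      refine mul_left_cancel₀ hn' ?_
      push_cast at e ⊢
      linear_combination -e + n * ih
  intro n hn
  rcases lt_or_ge n 0 with hneg | hpos
  · have e := h n (1 - n) hn (by omega) (by omega)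
    have e' := of_two_le (1 - n) (by omega)
    rw [add_sub_cancel] at e
    refine mul_left_cancel₀ (Int.cast_ne_zero.mpr hn) ?_
    push_cast at e e'
    linear_combination e + (1 - n) * e'
  · rcases eq_or_ne n 1 with rfl | hn1
    · push_cast; ring
    · exact of_two_le n (by omega)

theorem affine_eq_zero_or_of_mul_eq_zero {F : Type*} [Field F] [CharZero F] {α β γ δ : F}
    (h : ∀ n : ℤ, n ≠ 0 → (α * n + β) * (γ * n + δ) = 0) :
    (α = 0 ∧ β = 0) ∨ (γ = 0 ∧ δ = 0) := by
  have h₁ := h 1 (by omega)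
  have h₂ := h (-1) (by omega)
  have h₃ := h 2 (by omega)
  push_cast at h₁ h₂ h₃
  have hαγ : α * γ = 0 := by linear_combination (h₃ - 3 / 2 * h₁ + h₂ / 2) / 3
  have hβδ : β * δ = 0 := by linear_combination (h₁ + h₂) / 2 - hαγ
  have hcross : α * δ + β * γ = 0 := by linear_combination (h₁ - h₂) / 2
  rcases mul_eq_zero.mp hαγ with rfl | rfl
  · rcases eq_or_ne β 0 with rfl | hβ
    · exact .inl ⟨rfl, rfl⟩
    · exact .inr ⟨by simpa [hβ] using hcross, by simpa [hβ] using hβδ⟩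
  · rcases eq_or_ne δ 0 with rfl | hδ
    · exact .inr ⟨rfl, rfl⟩
    · exact .inl ⟨by simpa [hδ] using hcross, by simpa [hδ] using hβδ⟩

theorem eq_zero_of_forall_sum_mul_pow_eq_zero {F : Type*} [Field F] [CharZero F] {n : ℕ}
    {z : F} {c : Fin n → F} (h : ∀ k : ℕ, ∑ i, c i * (z + 2 * k) ^ (i : ℕ) = 0) : c = 0 :=
  Matrix.eq_zero_of_forall_index_sum_mul_pow_eq_zero (f := fun k : Fin n => z + 2 * (k : ℕ))
    (fun k l hkl => Fin.ext (by simpa using hkl)) fun k => h k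

/-- Parametrization of the nodal cubic `p² = β² (1 - 4 β)`. -/
theorem exists_nodal_cubic_parameter {F : Type*} [Field F] [CharZero F] {β p : F}
    (h : p ^ 2 = β ^ 2 * (1 - 4 * β)) :
    ∃ b : F, b ≠ 1 ∧ β = b * (1 - b) ∧ p = β * (1 - 2 * b) := by
  rcases eq_or_ne β 0 with rfl | hβ
  · exact ⟨0, zero_ne_one, by simp, by simpa using h⟩
  · have hb : β = (1 - p / β) / 2 * (1 - (1 - p / β) / 2) := by
      field_simp
      linear_combination h
    refine ⟨(1 - p / β) / 2, fun h1 => hβ ?_, hb, by field_simp; ring⟩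
    rw [hb, h1, sub_self, mul_zero]

/-! ### Structure constants of a graded module -/

/-- The structure constants of a graded module with basis `v_x`, `x ∈ ℤ`, on which
`L(y - x) v_x = L x y • v_y` and `I(y - x) v_x = I x y • v_y`, and on which `I(0)`, `C_L`, `C_I`,
`C_LI` are the scalars `c`, `cL`, `cI`, `cLI` and `L(0) v_x = (a + x) • v_x`. Indexing by the source
and target degrees turns brackets into relations between paths `x → y → z`. -/
structure IsStructureConstants (L I : ℤ → ℤ → ℂ) (a c cL cI cLI : ℂ) : Prop where
  L_self : ∀ x, L x x = a + x
  I_self : ∀ x, I x x = c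
  L_mul_L : ∀ x y y' z : ℤ, y + y' = x + z → L x y * L y z - L x y' * L y' z =
    ((y : ℂ) - y') * L x z + if x = z then (((y' : ℂ) - x) ^ 3 - (y' - x)) / 12 * cL else 0
  I_mul_L : ∀ x y y' z : ℤ, y + y' = x + z → I x y * L y z - L x y' * I y' z =
    ((y : ℂ) - x) * I x z + if x = z then (((y' : ℂ) - x) ^ 2 - (y' - x)) * cLI else 0
  I_mul_I : ∀ x y y' z : ℤ, y + y' = x + z → I x y * I y z - I x y' * I y' z =
    if x = z then ((y : ℂ) - x) * cI else 0

/-- The structure constants in the basis `g x • v_x`. -/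
noncomputable def rescale (g : ℤ → ℂ) (A : ℤ → ℤ → ℂ) (x y : ℤ) : ℂ := A x y * g x / g y

/-- The coefficient of `L(y - x) v_x` in `𝒜_{a,b,c}`, the module of densities. -/
def densityCoeff (a b : ℂ) (x y : ℤ) : ℂ := a + x + b * (y - x)

section Rescale

variable {g : ℤ → ℂ} {L I : ℤ → ℤ → ℂ} {a c cL cI cLI : ℂ}

theorem rescale_rescale (g g' : ℤ → ℂ) (A : ℤ → ℤ → ℂ) :
    rescale g' (rescale g A) = rescale (fun x => g x * g' x) A := by
  funext x y
  simp only [rescale, div_eq_mul_inv, mul_inv]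
  ring

theorem rescale_self (hg : ∀ x, g x ≠ 0) (A : ℤ → ℤ → ℂ) (x : ℤ) : rescale g A x x = A x x :=
  mul_div_cancel_right₀ _ (hg x)

theorem rescale_mul_rescale (hg : ∀ x, g x ≠ 0) (A B : ℤ → ℤ → ℂ) (x y z : ℤ) :
    rescale g A x y * rescale g B y z = A x y * B y z * (g x / g z) := by
  have := hg y
  unfold rescale
  field_simp

theorem rescale_loop₂ (hg : ∀ x, g x ≠ 0) (A B : ℤ → ℤ → ℂ) (x y : ℤ) :
    rescale g A x y * rescale g B y x = A x y * B y x := by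
  rw [rescale_mul_rescale hg, div_self (hg x), mul_one]

theorem rescale_loop₃ (hg : ∀ x, g x ≠ 0) (A B C : ℤ → ℤ → ℂ) (x y z : ℤ) :
    rescale g A x y * rescale g B y z * rescale g C z x = A x y * B y z * C z x := by
  have := hg x
  have := hg z
  rw [rescale_mul_rescale hg]
  unfold rescale
  field_simp

theorem IsStructureConstants.rescale (h : IsStructureConstants L I a c cL cI cLI)
    (hg : ∀ x, g x ≠ 0) :
    IsStructureConstants (rescale g L) (rescale g I) a c cL cI cLI where
  L_self x := by rw [rescale_self hg, h.L_self]
  I_self x := by rw [rescale_self hg, h.I_self]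
  L_mul_L x y y' z e := by
    rw [rescale_mul_rescale hg, rescale_mul_rescale hg, ← sub_mul, h.L_mul_L x y y' z e, add_mul,
      ite_mul, TwistedHV.rescale]
    congr 1
    · ring
    · split_ifs with hxz
      · rw [hxz, div_self (hg z), mul_one]
      · exact zero_mul _
  I_mul_L x y y' z e := by
    rw [rescale_mul_rescale hg, rescale_mul_rescale hg, ← sub_mul, h.I_mul_L x y y' z e, add_mul,
      ite_mul, TwistedHV.rescale]
    congr 1
    · ring
    · split_ifs with hxz
      · rw [hxz, div_self (hg z), mul_one]
      · exact zero_mul _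
  I_mul_I x y y' z e := by
    rw [rescale_mul_rescale hg, rescale_mul_rescale hg, ← sub_mul, h.I_mul_I x y y' z e, ite_mul]
    split_ifs with hxz
    · rw [hxz, div_self (hg z), mul_one]
    · exact zero_mul _

end Rescale

namespace IsStructureConstants

variable {L I : ℤ → ℤ → ℂ} {a c cL cI cLI : ℂ}

theorem L_mul_L_of_ne (h : IsStructureConstants L I a c cL cI cLI) {x y y' z : ℤ}
    (e : y + y' = x + z) (hne : x ≠ z) :
    L x y * L y z - L x y' * L y' z = ((y : ℂ) - y') * L x z := by
  rw [h.L_mul_L x y y' z e, if_neg hne, add_zero]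

theorem I_mul_L_of_ne (h : IsStructureConstants L I a c cL cI cLI) {x y y' z : ℤ}
    (e : y + y' = x + z) (hne : x ≠ z) :
    I x y * L y z - L x y' * I y' z = ((y : ℂ) - x) * I x z := by
  rw [h.I_mul_L x y y' z e, if_neg hne, add_zero]

theorem I_mul_I_of_ne (h : IsStructureConstants L I a c cL cI cLI) {x y y' z : ℤ}
    (e : y + y' = x + z) (hne : x ≠ z) : I x y * I y z = I x y' * I y' z :=
  sub_eq_zero.mp ((h.I_mul_I x y y' z e).trans (if_neg hne))

theorem periodic_L_mul_L (h : IsStructureConstants L I a c cL cI cLI) (n : ℤ) :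
    Function.Periodic (fun t : ℤ => L t (t + n) * L (t + n) t - (a + t) * (a + t + n) -
      (1 - n ^ 2) / 12 * cL * (a + t)) n := fun t => by
  have e := h.L_mul_L (t + n) (t + n + n) t (t + n) (by ring)
  rw [if_pos rfl, h.L_self] at e
  push_cast at e ⊢
  linear_combination e

theorem periodic_I_mul_L (h : IsStructureConstants L I a c cL cI cLI) (n : ℤ) :
    Function.Periodic (fun t : ℤ => I t (t + n) * L (t + n) t - (c + (n + 1) * cLI) * t) n :=
    fun t => by
  have e := h.I_mul_L (t + n) (t + n + n) t (t + n) (by ring)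
  rw [if_pos rfl, h.I_self] at e
  push_cast at e ⊢
  linear_combination e

theorem exists_loop₂ (h : IsStructureConstants L I a c cL cI cLI) :
    ∃ β, ∀ t : ℤ, L t (t + 1) * L (t + 1) t = (a + t) * (a + t + 1) + β := by
  obtain ⟨β, hβ⟩ := exists_const_of_periodic_one (h.periodic_L_mul_L 1)
  refine ⟨β, fun t => ?_⟩
  have := hβ t
  push_cast at this
  linear_combination this

theorem exists_loop₃ (h : IsStructureConstants L I a c cL cI cLI) {β : ℂ}
    (hβ : ∀ t : ℤ, L t (t + 1) * L (t + 1) t = (a + t) * (a + t + 1) + β) :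
    ∃ p, ∀ t : ℤ, L t (t + 2) * L (t + 2) (t + 1) * L (t + 1) t =
      (a + t + 1) ^ 3 + (3 * β - 1) * (a + t + 1) + p := by
  have hper : Function.Periodic (fun t : ℤ => L t (t + 2) * L (t + 2) (t + 1) * L (t + 1) t -
      ((a + t + 1) ^ 3 + (3 * β - 1) * (a + t + 1))) 1 := fun t => by
    have e := h.L_mul_L_of_ne (x := t + 1) (y := t + 3) (y' := t) (z := t + 2) (by ring) (by omega)
    have e' := hβ (t + 1)
    simp only [add_assoc, Int.reduceAdd] at e e' ⊢
    push_cast at e e' ⊢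
    linear_combination e * L (t + 2) (t + 1) + 3 * e'
  obtain ⟨p, hp⟩ := exists_const_of_periodic_one hper
  exact ⟨p, fun t => by linear_combination hp t⟩

theorem exists_loop₃' (h : IsStructureConstants L I a c cL cI cLI) {β : ℂ}
    (hβ : ∀ t : ℤ, L t (t + 1) * L (t + 1) t = (a + t) * (a + t + 1) + β) :
    ∃ q, ∀ t : ℤ, L t (t + 1) * L (t + 1) (t + 2) * L (t + 2) t =
      (a + t + 1) ^ 3 + (3 * β - 1) * (a + t + 1) + q := by
  have hper : Function.Periodic (fun t : ℤ => L t (t + 1) * L (t + 1) (t + 2) * L (t + 2) t -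
      ((a + t + 1) ^ 3 + (3 * β - 1) * (a + t + 1))) 1 := fun t => by
    have e := h.L_mul_L_of_ne (x := t + 2) (y := t + 3) (y' := t) (z := t + 1) (by ring) (by omega)
    have e' := hβ (t + 1)
    simp only [add_assoc, Int.reduceAdd] at e e' ⊢
    push_cast at e e' ⊢
    linear_combination e * L (t + 1) (t + 2) + 3 * e'
  obtain ⟨q, hq⟩ := exists_const_of_periodic_one hper
  exact ⟨q, fun t => by linear_combination hq t⟩

theorem exists_skip_loop₂ (h : IsStructureConstants L I a c cL cI cLI) :
    ∃ r, ∀ k : ℕ, L (2 * k) (2 * k + 2) * L (2 * k + 2) (2 * k) =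
      (a + 1 + 2 * k) ^ 2 - cL / 4 * (a + 1 + 2 * k) + r := by
  refine ⟨L 0 2 * L 2 0 - (a + 1) ^ 2 + cL / 4 * (a + 1), fun k => ?_⟩
  have e := (h.periodic_L_mul_L 2).nat_mul k 0
  simp only [zero_add, mul_comm (k : ℤ) 2] at e
  push_cast at e
  linear_combination e

/-- Multiplying the two loops through `t`, `t + 1`, `t + 2` in opposite directions gives the product
of the loops along their three edges. This is an identity of polynomials in `t`. -/
theorem loop_relations (h : IsStructureConstants L I a c cL cI cLI) {β p q : ℂ}
    (hβ : ∀ t : ℤ, L t (t + 1) * L (t + 1) t = (a + t) * (a + t + 1) + β)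
    (hp : ∀ t : ℤ, L t (t + 2) * L (t + 2) (t + 1) * L (t + 1) t =
      (a + t + 1) ^ 3 + (3 * β - 1) * (a + t + 1) + p)
    (hq : ∀ t : ℤ, L t (t + 1) * L (t + 1) (t + 2) * L (t + 2) t =
      (a + t + 1) ^ 3 + (3 * β - 1) * (a + t + 1) + q) :
    cL = 0 ∧ q = -p ∧ p ^ 2 = β ^ 2 * (1 - 4 * β) := by
  obtain ⟨r, hr⟩ := h.exists_skip_loop₂
  have hcoeff : ![p * q - r * β ^ 2, (3 * β - 1) * (p + q) + cL / 4 * β ^ 2,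
      (3 * β - 1) ^ 2 - β ^ 2 - r * (2 * β - 1), p + q + cL / 4 * (2 * β - 1),
      2 * (3 * β - 1) - (2 * β - 1) - r, cL / 4] = 0 := by
    refine eq_zero_of_forall_sum_mul_pow_eq_zero (z := a + 1) fun k => ?_
    have hedge := hβ (2 * k + 1)
    rw [add_assoc] at hedge
    have hprod := congrArg₂ (· * ·) (hp (2 * k)) (hq (2 * k))
    have hprod' := congrArg₂ (· * ·) (hr k) (congrArg₂ (· * ·) (hβ (2 * k)) hedge)
    simp only [Fin.sum_univ_six, Matrix.cons_val, Fin.coe_ofNat_eq_mod]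
    push_cast at hprod hprod' ⊢
    linear_combination hprod' - hprod
  have h₀ := congrFun hcoeff 0
  have h₃ := congrFun hcoeff 3
  have h₄ := congrFun hcoeff 4
  have h₅ := congrFun hcoeff 5
  simp only [Matrix.cons_val, Pi.zero_apply] at h₀ h₃ h₄ h₅
  have hcL : cL = 0 := by linear_combination 4 * h₅
  have hq : q = -p := by linear_combination h₃ - h₅ * (2 * β - 1)
  exact ⟨hcL, hq, by linear_combination p * hq - h₀ + β ^ 2 * h₄⟩

end IsStructureConstants

/-- The products of the coefficients `L` along loops through two or three consecutive degrees are
those of the module of densities `𝒜_{a,b,c}`. -/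
structure HasDensityLoops (L : ℤ → ℤ → ℂ) (a b : ℂ) : Prop where
  loop₂ : ∀ t : ℤ, L t (t + 1) * L (t + 1) t =
    densityCoeff a b t (t + 1) * densityCoeff a b (t + 1) t
  loop₃ : ∀ t : ℤ, L t (t + 2) * L (t + 2) (t + 1) * L (t + 1) t =
    densityCoeff a b t (t + 2) * densityCoeff a b (t + 2) (t + 1) * densityCoeff a b (t + 1) t
  loop₃' : ∀ t : ℤ, L t (t + 1) * L (t + 1) (t + 2) * L (t + 2) t =
    densityCoeff a b t (t + 1) * densityCoeff a b (t + 1) (t + 2) * densityCoeff a b (t + 2) t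

theorem HasDensityLoops.rescale {L : ℤ → ℤ → ℂ} {a b : ℂ} (h : HasDensityLoops L a b)
    {g : ℤ → ℂ} (hg : ∀ x, g x ≠ 0) : HasDensityLoops (rescale g L) a b where
  loop₂ t := (rescale_loop₂ hg ..).trans (h.loop₂ t)
  loop₃ t := (rescale_loop₃ hg ..).trans (h.loop₃ t)
  loop₃' t := (rescale_loop₃ hg ..).trans (h.loop₃' t)

theorem IsStructureConstants.exists_hasDensityLoops {L I : ℤ → ℤ → ℂ} {a c cL cI cLI : ℂ}
    (h : IsStructureConstants L I a c cL cI cLI) : cL = 0 ∧ ∃ b ≠ 1, HasDensityLoops L a b := by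
  obtain ⟨β, hβ⟩ := h.exists_loop₂
  obtain ⟨p, hp⟩ := h.exists_loop₃ hβ
  obtain ⟨q, hq⟩ := h.exists_loop₃' hβ
  obtain ⟨hcL, rfl, hcubic⟩ := h.loop_relations hβ hp hq
  obtain ⟨b, hb, rfl, rfl⟩ := exists_nodal_cubic_parameter hcubic
  refine ⟨hcL, b, hb, fun t => (hβ t).trans ?_, fun t => (hp t).trans ?_,
    fun t => (hq t).trans ?_⟩ <;>
  · simp only [densityCoeff]
    push_cast
    ring

/-! ### Normalization in large degrees -/

section

variable {L I : ℤ → ℤ → ℂ} {a b c cL cI cLI : ℂ} {T : ℤ}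

theorem exists_rescale_step_eq {A D : ℤ → ℤ → ℂ} (hA : ∀ t, T ≤ t → A t (t + 1) ≠ 0)
    (hD : ∀ t, T ≤ t → D t (t + 1) ≠ 0) :
    ∃ g : ℤ → ℂ, (∀ x, g x ≠ 0) ∧ ∀ t, T ≤ t → rescale g A t (t + 1) = D t (t + 1) := by
  set g : ℤ → ℂ := fun t => ∏ j ∈ Finset.Ico T t, A j (j + 1) / D j (j + 1) with hg
  have hg0 : ∀ x, g x ≠ 0 := fun x => Finset.prod_ne_zero_iff.mpr fun j hj =>
    div_ne_zero (hA j (Finset.mem_Ico.mp hj).1) (hD j (Finset.mem_Ico.mp hj).1)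
  refine ⟨g, hg0, fun t ht => ?_⟩
  have hsucc : g (t + 1) = A t (t + 1) / D t (t + 1) * g t := by
    simp only [hg]
    rw [← Finset.insert_Ico_right_eq_Ico_add_one ht, Finset.prod_insert Finset.right_notMem_Ico]
  have := hg0 t
  have := hA t ht
  have := hD t ht
  rw [rescale, hsucc]
  field_simp

theorem eventually_densityCoeff_step_ne_zero (a b : ℂ) : ∀ᶠ t : ℤ in atTop,
    densityCoeff a b t (t + 1) ≠ 0 ∧ densityCoeff a b (t + 1) t ≠ 0 := by
  filter_upwards [eventually_add_intCast_ne_zero (a + b),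
    eventually_add_intCast_ne_zero (a + 1 - b)] with t ht ht'
  simp only [densityCoeff]
  push_cast
  exact ⟨fun h0 => ht (by linear_combination h0), fun h0 => ht' (by linear_combination h0)⟩

theorem IsStructureConstants.eq_densityCoeff_of_steps
    (h : IsStructureConstants L I a c 0 cI cLI)
    (h₁ : ∀ t : ℤ, T ≤ t → L t (t + 1) = densityCoeff a b t (t + 1) ∧
      L (t + 1) t = densityCoeff a b (t + 1) t)
    (h₂ : ∀ t : ℤ, T ≤ t → L t (t + 2) = densityCoeff a b t (t + 2) ∧
      L (t + 2) t = densityCoeff a b (t + 2) t)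
    {x y : ℤ} (hx : T ≤ x) (hy : T ≤ y) : L x y = densityCoeff a b x y := by
  have of_two_le : ∀ n : ℤ, 2 ≤ n → ∀ t, T ≤ t → L t (t + n) = densityCoeff a b t (t + n) ∧
      L (t + n) t = densityCoeff a b (t + n) t := by
    intro n hn
    induction n, hn using Int.leInduction with
    | base => exact h₂
    | succ n hn ih =>
      intro t ht
      have hn' : (n : ℂ) - 1 ≠ 0 := sub_ne_zero.mpr (by exact_mod_cast (by omega : n ≠ 1))
      have hup := h.L_mul_L_of_ne (x := t) (y := t + n) (y' := t + 1) (z := t + (n + 1))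
        (by ring) (by omega)
      have hdown := h.L_mul_L_of_ne (x := t + (n + 1)) (y := t + n) (y' := t + 1) (z := t)
        (by ring) (by omega)
      have ih' := ih (t + 1) (by omega)
      have hs := h₁ (t + n) (by omega)
      rw [add_right_comm, add_assoc] at ih'
      rw [add_assoc] at hs
      rw [(ih t ht).1, ih'.1, (h₁ t ht).1, hs.1] at hup
      rw [(ih t ht).2, ih'.2, (h₁ t ht).2, hs.2] at hdown
      simp only [densityCoeff] at hup hdown ⊢
      push_cast at hup hdown ⊢
      constructor <;> refine mul_left_cancel₀ hn' ?_
      · linear_combination -hup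
      · linear_combination -hdown
  have of_nonneg : ∀ n : ℤ, 0 ≤ n → ∀ t, T ≤ t → L t (t + n) = densityCoeff a b t (t + n) ∧
      L (t + n) t = densityCoeff a b (t + n) t := by
    intro n hn t ht
    obtain rfl | rfl | hn : n = 0 ∨ n = 1 ∨ 2 ≤ n := by omega
    · simp [h.L_self, densityCoeff]
    · exact h₁ t ht
    · exact of_two_le n hn t ht
  rcases le_total x y with hxy | hxy
  · simpa using (of_nonneg (y - x) (by omega) x hx).1
  · simpa using (of_nonneg (x - y) (by omega) y hy).2

theorem HasDensityLoops.eq_densityCoeff_of_step (hloop : HasDensityLoops L a b)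
    (h : IsStructureConstants L I a c 0 cI cLI)
    (hD : ∀ t, T ≤ t → densityCoeff a b t (t + 1) ≠ 0 ∧ densityCoeff a b (t + 1) t ≠ 0)
    (hstep : ∀ t, T ≤ t → L t (t + 1) = densityCoeff a b t (t + 1))
    {x y : ℤ} (hx : T ≤ x) (hy : T ≤ y) : L x y = densityCoeff a b x y := by
  have h₁ : ∀ t, T ≤ t → L t (t + 1) = densityCoeff a b t (t + 1) ∧
      L (t + 1) t = densityCoeff a b (t + 1) t := fun t ht =>
    ⟨hstep t ht, mul_left_cancel₀ (hD t ht).1 (by rw [← hloop.loop₂, hstep t ht])⟩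
  refine h.eq_densityCoeff_of_steps h₁ (fun t ht => ?_) hx hy
  have hs := h₁ (t + 1) (by omega)
  have hD' := hD (t + 1) (by omega)
  simp only [add_assoc, Int.reduceAdd] at hs hD'
  constructor
  · refine mul_right_cancel₀ (mul_ne_zero hD'.2 (hD t ht).2) ?_
    rw [← mul_assoc, ← mul_assoc, ← hloop.loop₃, (h₁ t ht).2, hs.2]
  · refine mul_left_cancel₀ (mul_ne_zero (hD t ht).1 hD'.1) ?_
    rw [← hloop.loop₃', (h₁ t ht).1, hs.1]

theorem IsStructureConstants.exists_rescale_eq_densityCoeff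
    (h : IsStructureConstants L I a c cL cI cLI) : cL = 0 ∧ ∃ b ≠ 1, ∃ g : ℤ → ℂ,
      (∀ x, g x ≠ 0) ∧ ∃ T : ℤ, ∀ x y, T ≤ x → T ≤ y →
        TwistedHV.rescale g L x y = densityCoeff a b x y := by
  obtain ⟨rfl, b, hb, hloop⟩ := h.exists_hasDensityLoops
  obtain ⟨T, hD⟩ := eventually_atTop.mp (eventually_densityCoeff_step_ne_zero a b)
  have hL : ∀ t, T ≤ t → L t (t + 1) ≠ 0 := fun t ht =>
    left_ne_zero_of_mul (hloop.loop₂ t ▸ mul_ne_zero (hD t ht).1 (hD t ht).2)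
  obtain ⟨g, hg, hstep⟩ := exists_rescale_step_eq hL fun t ht => (hD t ht).1
  exact ⟨rfl, b, hb, g, hg, T, fun x y hx hy =>
    (hloop.rescale hg).eq_densityCoeff_of_step (h.rescale hg) hD hstep hx hy⟩

/-- The structure constants agree with those of `𝒜_{a,b,c}` in degrees at least `T`. -/
structure IsDensityFrom (T : ℤ) (L I : ℤ → ℤ → ℂ) (a b c : ℂ) : Prop where
  L_eq : ∀ x y, T ≤ x → T ≤ y → L x y = densityCoeff a b x y
  I_eq : ∀ x y, T ≤ x → T ≤ y → I x y = c

theorem IsDensityFrom.eventually (hT : IsDensityFrom T L I a b c) (x y : ℤ) :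
    ∀ᶠ t in atTop,
      L (x + t) (y + t) = densityCoeff a b (x + t) (y + t) ∧ I (x + t) (y + t) = c := by
  filter_upwards [eventually_ge_atTop (T - x), eventually_ge_atTop (T - y)] with t hx hy
  exact ⟨hT.L_eq _ _ (by omega) (by omega), hT.I_eq _ _ (by omega) (by omega)⟩

end

namespace IsStructureConstants

variable {L I : ℤ → ℤ → ℂ} {a b c cL cI cLI r : ℂ} {T : ℤ}

/-- Since `⁅I(1), L(1)⁆` is a multiple of `I(2)`, the coefficients of `I(1)` determine those of
`I(2)`. The loops `t → t + 2 → t` then give an identity of polynomials in `t`. -/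
theorem I_one_relations (h : IsStructureConstants L I a c 0 cI cLI) (hb : b ≠ 1)
    (hL : ∀ x y, T ≤ x → T ≤ y → L x y = densityCoeff a b x y)
    (hr : ∀ t : ℤ, T ≤ t → I t (t + 1) * (a + t + 1 - b) = (c + 2 * cLI) * (a + t + 1 - b) + r) :
    cLI = 0 ∧ r * b = 0 := by
  obtain ⟨B, hB⟩ : ∃ B, ∀ k : ℕ, I (T + 2 * k) (T + 2 * k + 2) *
      densityCoeff a b (T + 2 * k + 2) (T + 2 * k) =
        (c + 3 * cLI) * (a + (T + 2 * k : ℤ)) + B := by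
    refine ⟨I T (T + 2) * L (T + 2) T - (c + 3 * cLI) * (a + T), fun k => ?_⟩
    have e := (h.periodic_I_mul_L 2).nat_mul k T
    simp only [mul_comm (k : ℤ) 2] at e
    rw [← hL _ _ (by omega) (by omega)]
    push_cast at e ⊢
    linear_combination e
  have hcoeff : ![((c + 2 * cLI) * (2 - 2 * b) - B) * ((1 - b) * (2 - b)) + 2 * r * (2 - 2 * b),
      -cLI * ((1 - b) * (2 - b)) + ((c + 2 * cLI) * (2 - 2 * b) - B) * (3 - 2 * b) +
        2 * r * (3 - 2 * b),
      -cLI * (3 - 2 * b) + ((c + 2 * cLI) * (2 - 2 * b) - B) + 2 * r, -cLI] = 0 := by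
    refine eq_zero_of_forall_sum_mul_pow_eq_zero (z := a + T) fun k => ?_
    have ht : T ≤ T + 2 * k := by omega
    have hz : a + T + 2 * k = a + (T + 2 * k : ℤ) := by push_cast; ring
    have hskip := hB k
    rw [hz]
    generalize T + 2 * (k : ℤ) = t at ht hskip
    have e := h.I_mul_L_of_ne (x := t) (y := t + 1) (y' := t + 1) (z := t + 2)
      (by ring) (by omega)
    have hr₁ := hr t ht
    have hr₂ := hr (t + 1) (by omega)
    rw [add_assoc _ 1 1] at hr₂
    rw [hL _ _ (by omega) (by omega), hL _ _ (by omega) (by omega)] at e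
    simp only [Fin.sum_univ_four, Matrix.cons_val, Fin.coe_ofNat_eq_mod, densityCoeff]
      at e hskip ⊢
    push_cast at e hskip hr₂ ⊢
    linear_combination -((a + t + 2 - b) * (a + t + 1 + b) * (a + t + 2 - 2 * b)) * hr₁ +
      ((a + t + b) * (a + t + 1 - b) * (a + t + 2 - 2 * b)) * hr₂ +
      ((a + t + 1 - b) * (a + t + 2 - b)) * ((a + t + 2 - 2 * b) * e + hskip)
  have h₀ := congrFun hcoeff 0
  have h₂ := congrFun hcoeff 2
  have h₃ := congrFun hcoeff 3
  simp only [Matrix.cons_val, Pi.zero_apply] at h₀ h₂ h₃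
  have hrb : r * b * (1 - b) = 0 := by
    linear_combination (h₀ - (h₂ - (3 - 2 * b) * h₃) * ((1 - b) * (2 - b))) / 2
  exact ⟨neg_eq_zero.mp h₃, (mul_eq_zero.mp hrb).resolve_right (sub_ne_zero.mpr hb.symm)⟩

theorem exists_I_one (h : IsStructureConstants L I a c 0 cI cLI) (hb : b ≠ 1)
    (hL : ∀ x y, T ≤ x → T ≤ y → L x y = densityCoeff a b x y) :
    cLI = 0 ∧ ∃ r : ℂ, r * b = 0 ∧
      ∀ t : ℤ, T ≤ t → I t (t + 1) * (a + t + 1 - b) = c * (a + t + 1 - b) + r := by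
  obtain ⟨B, hB⟩ := exists_const_of_periodic_one (h.periodic_I_mul_L 1)
  have hr : ∀ t : ℤ, T ≤ t → I t (t + 1) * (a + t + 1 - b) =
      (c + 2 * cLI) * (a + t + 1 - b) + (B - (c + 2 * cLI) * (a + 1 - b)) := fun t ht => by
    have e := hB t
    rw [hL _ _ (by omega) (by omega), densityCoeff] at e
    push_cast at e
    linear_combination e
  obtain ⟨rfl, hrb⟩ := h.I_one_relations hb hL hr
  exact ⟨rfl, _, hrb, fun t ht => by simpa only [mul_zero, add_zero] using hr t ht⟩

theorem isDensityFrom_of_I_one (h : IsStructureConstants L I a c cL cI cLI)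
    (hL : ∀ x y, T ≤ x → T ≤ y → L x y = densityCoeff a b x y)
    (hI : ∀ t : ℤ, T ≤ t → I t (t + 1) = c) : IsDensityFrom (T + 1) L I a b c where
  L_eq x y hx hy := hL x y (by omega) (by omega)
  I_eq x y hx hy := by
    rcases eq_or_ne x y with rfl | hne
    · exact h.I_self x
    · have e := h.I_mul_L_of_ne (x := x) (y := x + 1) (y' := y - 1) (z := y) (by ring) hne
      have hlast := hI (y - 1) (by omega)
      rw [sub_add_cancel] at hlast
      rw [hI x (by omega), hlast, hL _ _ (by omega) (by omega), hL _ _ (by omega) (by omega),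
        densityCoeff, densityCoeff] at e
      push_cast at e
      linear_combination -e

theorem I_two_of_I_one (h : IsStructureConstants L I a c cL cI cLI)
    (hL : ∀ x y, T ≤ x → T ≤ y → L x y = densityCoeff a 0 x y)
    (ha : ∀ t : ℤ, T ≤ t → a + t ≠ 0)
    (hI : ∀ t : ℤ, T ≤ t → I t (t + 1) = c + r / (a + (t + 1 : ℤ))) {t : ℤ} (ht : T ≤ t) :
    I t (t + 2) = c + 2 * r / (a + (t + 2 : ℤ)) := by
  have e := h.I_mul_L_of_ne (x := t) (y := t + 1) (y' := t + 1) (z := t + 2) (by ring) (by omega)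
  have hI₁ := hI (t + 1) (by omega)
  have ha₁ := ha (t + 1) (by omega)
  have ha₂ := ha (t + 2) (by omega)
  simp only [add_assoc, Int.reduceAdd] at hI₁
  rw [hI t ht, hI₁, hL _ _ (by omega) (by omega), hL _ _ (by omega) (by omega), densityCoeff,
    densityCoeff] at e
  push_cast at e ha₁ ha₂ ⊢
  field_simp at e ⊢
  refine mul_left_cancel₀ ha₁ ?_
  linear_combination -e

theorem mul_add_eq_zero_of_I_one (h : IsStructureConstants L I a c cL cI cLI)
    (hL : ∀ x y, T ≤ x → T ≤ y → L x y = densityCoeff a 0 x y)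
    (ha : ∀ t : ℤ, T ≤ t → a + t ≠ 0)
    (hI : ∀ t : ℤ, T ≤ t → I t (t + 1) = c + r / (a + (t + 1 : ℤ))) : r * (r + c) = 0 := by
  have e := h.I_mul_I_of_ne (x := T) (y := T + 1) (y' := T + 2) (z := T + 3) (by ring) (by omega)
  have hI₁ := hI (T + 2) (by omega)
  have hI₂ := h.I_two_of_I_one hL ha hI (t := T + 1) (by omega)
  have ha₁ := ha (T + 1) (by omega)
  have ha₂ := ha (T + 2) (by omega)
  have ha₃ := ha (T + 3) (by omega)
  simp only [add_assoc, Int.reduceAdd] at hI₁ hI₂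
  rw [hI T le_rfl, h.I_two_of_I_one hL ha hI le_rfl, hI₁, hI₂] at e
  push_cast at e ha₁ ha₂ ha₃
  field_simp at e
  linear_combination e / 2

/-- The function `(a + t)⁻¹` intertwines the modules of densities `𝒜_{a,0,c}` and `𝒜_{a,1,c}` in
large degrees. -/
theorem exists_rescale_isDensityFrom_one (h : IsStructureConstants L I a c cL cI cLI)
    (hL : ∀ x y, T ≤ x → T ≤ y → L x y = densityCoeff a 0 x y)
    (ha : ∀ t : ℤ, T ≤ t → a + t ≠ 0)
    (hI : ∀ t : ℤ, T ≤ t → I t (t + 1) = c + -c / (a + (t + 1 : ℤ))) :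
    ∃ g : ℤ → ℂ, (∀ x, g x ≠ 0) ∧
      IsDensityFrom (T + 1) (TwistedHV.rescale g L) (TwistedHV.rescale g I) a 1 c := by
  set g : ℤ → ℂ := fun t => if T ≤ t then (a + t)⁻¹ else 1 with hg
  have hg0 : ∀ x, g x ≠ 0 := fun x => by
    simp only [hg]
    split_ifs with hx
    · exact inv_ne_zero (ha x hx)
    · exact one_ne_zero
  have hgT : ∀ x : ℤ, T ≤ x → g x = (a + x)⁻¹ := fun x hx => if_pos hx
  refine ⟨g, hg0, (h.rescale hg0).isDensityFrom_of_I_one (fun x y hx hy => ?_) fun t ht => ?_⟩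
  · have hax := ha x hx
    rw [TwistedHV.rescale, hL x y hx hy, hgT x hx, hgT y hy, densityCoeff, densityCoeff]
    field_simp
    ring
  · have hat := ha t ht
    have hat₁ := ha (t + 1) (by omega)
    rw [TwistedHV.rescale, hI t ht, hgT t ht, hgT (t + 1) (by omega)]
    push_cast at hat₁ ⊢
    field_simp
    ring

theorem exists_rescale_isDensityFrom_of_L_eq (h : IsStructureConstants L I a c 0 cI cLI)
    (hb : b ≠ 1) (hL : ∀ x y, T ≤ x → T ≤ y → L x y = densityCoeff a b x y) :
    cLI = 0 ∧ ∃ (b' : ℂ) (g : ℤ → ℂ), (∀ x, g x ≠ 0) ∧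
      ∃ T', IsDensityFrom T' (TwistedHV.rescale g L) (TwistedHV.rescale g I) a b' c := by
  obtain ⟨hcLI, r, hrb, hr⟩ := h.exists_I_one hb hL
  refine ⟨hcLI, ?_⟩
  rcases eq_or_ne r 0 with rfl | hr0
  · obtain ⟨S, hS⟩ := eventually_atTop.mp (eventually_add_intCast_ne_zero (a + 1 - b))
    refine ⟨b, 1, fun _ => one_ne_zero, max S T + 1, ?_⟩
    refine (h.rescale fun _ => one_ne_zero).isDensityFrom_of_I_one (fun x y hx hy => ?_)
      fun t ht => ?_
    · simpa [TwistedHV.rescale] using hL x y (by omega) (by omega)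
    · have ht0 : a + t + 1 - b ≠ 0 := fun h0 => hS t (by omega) (by linear_combination h0)
      simpa [TwistedHV.rescale, ht0] using hr t (by omega)
  · obtain rfl : b = 0 := (mul_eq_zero.mp hrb).resolve_left hr0
    obtain ⟨S, ha⟩ := eventually_atTop.mp (eventually_add_intCast_ne_zero a)
    have hL' : ∀ x y, max S T ≤ x → max S T ≤ y → L x y = densityCoeff a 0 x y :=
      fun x y hx hy => hL x y (by omega) (by omega)
    have ha' : ∀ t : ℤ, max S T ≤ t → a + t ≠ 0 := fun t ht => ha t (by omega)
    have hI : ∀ t : ℤ, max S T ≤ t → I t (t + 1) = c + r / (a + (t + 1 : ℤ)) := fun t ht => by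
      have hat := ha' (t + 1) (by omega)
      have e := hr t (by omega)
      push_cast at hat ⊢
      field_simp
      linear_combination e
    obtain rfl : r = -c := eq_neg_of_add_eq_zero_left
      ((mul_eq_zero.mp (h.mul_add_eq_zero_of_I_one hL' ha' hI)).resolve_left hr0)
    obtain ⟨g, hg, hT⟩ := h.exists_rescale_isDensityFrom_one hL' ha' hI
    exact ⟨1, g, hg, _, hT⟩

theorem exists_rescale_isDensityFrom (h : IsStructureConstants L I a c cL cI cLI) :
    cL = 0 ∧ cI = 0 ∧ cLI = 0 ∧ ∃ (b : ℂ) (g : ℤ → ℂ), (∀ x, g x ≠ 0) ∧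
      ∃ T, IsDensityFrom T (TwistedHV.rescale g L) (TwistedHV.rescale g I) a b c := by
  obtain ⟨rfl, b, hb, g, hg, T, hL⟩ := h.exists_rescale_eq_densityCoeff
  obtain ⟨rfl, b', g', hg', T', hT⟩ := (h.rescale hg).exists_rescale_isDensityFrom_of_L_eq hb hL
  rw [rescale_rescale, rescale_rescale] at hT
  have hgg' : ∀ x, g x * g' x ≠ 0 := fun x => mul_ne_zero (hg x) (hg' x)
  have hcI := (h.rescale hgg').I_mul_I (T' + 1) (T' + 2) T' (T' + 1) (by ring)
  rw [hT.I_eq _ _ (by omega) (by omega), hT.I_eq _ _ (by omega) (by omega),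
    hT.I_eq _ _ (by omega) (by omega), hT.I_eq _ _ (by omega) (by omega), if_pos rfl] at hcI
  push_cast at hcI
  exact ⟨rfl, by linear_combination -hcI, rfl, b', _, hgg', T', hT⟩

end IsStructureConstants

/-! ### Products along loops -/

/-- The difference between the products of `A, B, B` and of `A', B', B'` along the loop
`x → y → z → x`. -/
def loopDefect (A B A' B' : ℤ → ℤ → ℂ) (x y z : ℤ) : ℂ :=
  A x y * B y z * B z x - A' x y * B' y z * B' z x

namespace IsStructureConstants

variable {L I : ℤ → ℤ → ℂ} {a b c : ℂ} {T x y y' z z' : ℤ}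

theorem L_self_eq_densityCoeff (h : IsStructureConstants L I a c 0 0 0) (b : ℂ) (x : ℤ) :
    L x x = densityCoeff a b x x := by
  rw [h.L_self, densityCoeff, sub_self, mul_zero, add_zero]

theorem L_mul_L_loop₂ (h : IsStructureConstants L I a c 0 0 0) (hT : IsDensityFrom T L I a b c)
    (x y : ℤ) : L x y * L y x = densityCoeff a b x y * densityCoeff a b y x := by
  obtain ⟨n, rfl⟩ : ∃ n, y = x + n := ⟨y - x, by ring⟩
  rcases eq_or_ne n 0 with rfl | hn
  · rw [add_zero, h.L_self_eq_densityCoeff b]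
  have key := forall_of_periodic_of_eventually (h.periodic_L_mul_L n) hn
    (P := (· = b * (1 - b) * n ^ 2)) (by
      filter_upwards [hT.eventually 0 n, hT.eventually n 0] with t h₁ h₂
      rw [zero_add, add_comm n] at h₁ h₂
      rw [h₁.1, h₂.1, densityCoeff, densityCoeff]
      push_cast
      ring) x
  rw [densityCoeff, densityCoeff]
  push_cast
  linear_combination key

theorem I_mul_L_loop₂ (h : IsStructureConstants L I a c 0 0 0) (hT : IsDensityFrom T L I a b c)
    (x y : ℤ) : I x y * L y x = c * densityCoeff a b y x := by
  obtain ⟨n, rfl⟩ : ∃ n, y = x + n := ⟨y - x, by ring⟩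
  rcases eq_or_ne n 0 with rfl | hn
  · rw [add_zero, h.L_self_eq_densityCoeff b, h.I_self]
  have key := forall_of_periodic_of_eventually (h.periodic_I_mul_L n) hn
    (P := (· = c * (a + n - b * n))) (by
      filter_upwards [hT.eventually 0 n, hT.eventually n 0] with t h₁ h₂
      rw [zero_add, add_comm n] at h₁ h₂
      rw [h₁.2, h₂.1, densityCoeff]
      push_cast
      ring) x
  rw [densityCoeff]
  push_cast
  linear_combination key

theorem loopDefect_L_swap (h : IsStructureConstants L I a c 0 0 0)
    (hT : IsDensityFrom T L I a b c) (e : y + y' = x + z) (hne : x ≠ z) :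
    loopDefect L L (densityCoeff a b) (densityCoeff a b) x y z =
      loopDefect L L (densityCoeff a b) (densityCoeff a b) x y' z := by
  have h₁ := h.L_mul_L_of_ne e hne
  have h₂ := h.L_mul_L_loop₂ hT x z
  obtain rfl : y' = x + z - y := by omega
  simp only [loopDefect, densityCoeff] at h₂ ⊢
  push_cast at h₁ ⊢
  linear_combination h₁ * L z x + ((y : ℂ) - (x + z - y)) * h₂

theorem loopDefect_L_rotate (L D : ℤ → ℤ → ℂ) (x y z : ℤ) :
    loopDefect L L D D x y z = loopDefect L L D D y z x := by
  simp only [loopDefect]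
  ring

/-- Reflecting one vertex and then another of a loop translates it. -/
theorem loopDefect_L_add (h : IsStructureConstants L I a c 0 0 0)
    (hT : IsDensityFrom T L I a b c) (hxz : x ≠ z) (hyz : y ≠ z) :
    loopDefect L L (densityCoeff a b) (densityCoeff a b) (x + (x - y)) (y + (x - y)) (z + (x - y)) =
      loopDefect L L (densityCoeff a b) (densityCoeff a b) x y z := by
  rw [h.loopDefect_L_swap hT (show y + (x + z - y) = x + z by ring) hxz,
    loopDefect_L_rotate _ _ x,
    h.loopDefect_L_swap hT (show z + (x + (x - y)) = x + z - y + x by ring) (by omega),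
    loopDefect_L_rotate _ _ (x + z - y)]
  congr 1 <;> ring

theorem L_mul_L_mul_L_loop₃ (h : IsStructureConstants L I a c 0 0 0)
    (hT : IsDensityFrom T L I a b c) (x y z : ℤ) :
    L x y * L y z * L z x = densityCoeff a b x y * densityCoeff a b y z * densityCoeff a b z x := by
  rcases eq_or_ne x z with rfl | hxz
  · rw [h.L_mul_L_loop₂ hT, h.L_self_eq_densityCoeff b]
  rcases eq_or_ne y z with rfl | hyz
  · rw [mul_right_comm, h.L_mul_L_loop₂ hT, h.L_self_eq_densityCoeff b, mul_right_comm]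
  rcases eq_or_ne x y with rfl | hxy
  · rw [mul_assoc, h.L_mul_L_loop₂ hT, h.L_self_eq_densityCoeff b, mul_assoc]
  have hper : Function.Periodic (fun t => loopDefect L L (densityCoeff a b) (densityCoeff a b)
      (x + t) (y + t) (z + t)) (x - y) := fun t => by
    beta_reduce
    rw [← h.loopDefect_L_add hT (x := x + t) (y := y + t) (by omega) (by omega)]
    congr 1 <;> ring
  have key := forall_of_periodic_of_eventually hper (sub_ne_zero.mpr hxy) (P := (· = 0)) (by
    filter_upwards [hT.eventually x y, hT.eventually y z, hT.eventually z x] with t h₁ h₂ h₃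
    rw [loopDefect, h₁.1, h₂.1, h₃.1, sub_self]) 0
  simpa only [loopDefect, add_zero, sub_eq_zero] using key

theorem loopDefect_I_swap (h : IsStructureConstants L I a c 0 0 0)
    (hT : IsDensityFrom T L I a b c) (e : y + y' = x + z) (hne : x ≠ z) :
    loopDefect I L (fun _ _ => c) (densityCoeff a b) x y z =
      loopDefect I L (fun _ _ => c) (densityCoeff a b) y' z x := by
  have h₁ := h.I_mul_L_of_ne e hne
  have h₂ := h.I_mul_L_loop₂ hT x z
  obtain rfl : y' = x + z - y := by omega
  simp only [loopDefect, densityCoeff] at h₂ ⊢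
  push_cast at h₁ ⊢
  linear_combination h₁ * L z x + ((y : ℂ) - x) * h₂

theorem loopDefect_I_swap' (h : IsStructureConstants L I a c 0 0 0)
    (hT : IsDensityFrom T L I a b c) (e : z + z' = x + y) (hne : x ≠ y) :
    loopDefect I L (fun _ _ => c) (densityCoeff a b) x y z =
      loopDefect I L (fun _ _ => c) (densityCoeff a b) x y z' := by
  have h₁ := h.L_mul_L_of_ne (e.trans (add_comm x y)) hne.symm
  have h₂ := h.I_mul_L_loop₂ hT x y
  obtain rfl : z' = x + y - z := by omega
  simp only [loopDefect, densityCoeff] at h₂ ⊢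
  push_cast at h₁ ⊢
  linear_combination h₁ * I x y + ((z : ℂ) - (x + y - z)) * h₂

theorem loopDefect_I_add (h : IsStructureConstants L I a c 0 0 0)
    (hT : IsDensityFrom T L I a b c) (hxz : x ≠ z) (hxy : x ≠ y) :
    loopDefect I L (fun _ _ => c) (densityCoeff a b) (x + (z - y)) (y + (z - y)) (z + (z - y)) =
      loopDefect I L (fun _ _ => c) (densityCoeff a b) x y z := by
  rw [h.loopDefect_I_swap hT (show y + (x + z - y) = x + z by ring) hxz,
    h.loopDefect_I_swap' hT (show x + (z + (z - y)) = x + z - y + z by ring) (by omega)]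
  congr 1 <;> ring

theorem I_mul_L_mul_L_loop₃ (h : IsStructureConstants L I a c 0 0 0)
    (hT : IsDensityFrom T L I a b c) (x y z : ℤ) :
    I x y * L y z * L z x = c * densityCoeff a b y z * densityCoeff a b z x := by
  rcases eq_or_ne x z with rfl | hxz
  · rw [h.I_mul_L_loop₂ hT, h.L_self_eq_densityCoeff b]
  rcases eq_or_ne y z with rfl | hyz
  · rw [mul_right_comm, h.I_mul_L_loop₂ hT, h.L_self_eq_densityCoeff b, mul_right_comm]
  rcases eq_or_ne x y with rfl | hxy
  · rw [mul_assoc, h.L_mul_L_loop₂ hT, h.I_self, mul_assoc]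
  have hper : Function.Periodic (fun t => loopDefect I L (fun _ _ => c) (densityCoeff a b)
      (x + t) (y + t) (z + t)) (z - y) := fun t => by
    beta_reduce
    rw [← h.loopDefect_I_add hT (y := y + t) (z := z + t) (by omega) (by omega)]
    congr 1 <;> ring
  have key := forall_of_periodic_of_eventually hper (sub_ne_zero.mpr hyz.symm) (P := (· = 0)) (by
    filter_upwards [hT.eventually x y, hT.eventually y z, hT.eventually z x] with t h₁ h₂ h₃
    rw [loopDefect, h₁.2, h₂.1, h₃.1, sub_self]) 0
  simpa only [loopDefect, add_zero, sub_eq_zero] using key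

end IsStructureConstants

/-! ### Normalization in regular degrees -/

/-- The degree `x` is connected to all large degrees in both directions by nonzero coefficients
`densityCoeff a b`. -/
def IsRegular (a b : ℂ) (x : ℤ) : Prop := b * (1 - b) ≠ 0 ∨ a + x ≠ 0

section

variable {L I : ℤ → ℤ → ℂ} {a b c : ℂ} {T : ℤ}

theorem eventually_isRegular (a b : ℂ) : ∀ᶠ x : ℤ in atTop, IsRegular a b x :=
  (eventually_add_intCast_ne_zero a).mono fun _ => .inr

theorem eventually_densityCoeff_ne_zero_of_ne {x : ℤ} (h : b ≠ 0 ∨ a + x ≠ 0) :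
    ∀ᶠ z in atTop, densityCoeff a b x z ≠ 0 := by
  rcases eq_or_ne b 0 with rfl | hb
  · exact .of_forall fun z => by simpa [densityCoeff] using h
  · filter_upwards [eventually_add_intCast_ne_zero ((a + x) / b - x)] with z hz h0
    rw [densityCoeff] at h0
    refine hz ?_
    field_simp
    linear_combination h0

theorem densityCoeff_one_sub (a b : ℂ) (x y : ℤ) :
    densityCoeff a (1 - b) x y = densityCoeff a b y x := by
  simp only [densityCoeff]
  ring

theorem IsRegular.eventually_densityCoeff_ne_zero {x : ℤ} (h : IsRegular a b x) :
    ∀ᶠ z in atTop, densityCoeff a b x z ≠ 0 ∧ densityCoeff a b z x ≠ 0 := by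
  refine (eventually_densityCoeff_ne_zero_of_ne (h.imp_left left_ne_zero_of_mul)).and ?_
  simpa only [densityCoeff_one_sub] using
    eventually_densityCoeff_ne_zero_of_ne (h.imp_left right_ne_zero_of_mul)

theorem IsRegular.exists_gauge {x : ℤ} (hx : IsRegular a b x)
    (h : IsStructureConstants L I a c 0 0 0) (hT : IsDensityFrom T L I a b c) :
    ∃ g : ℂ, g ≠ 0 ∧ ∀ᶠ z in atTop, densityCoeff a b x z ≠ 0 ∧ densityCoeff a b z x ≠ 0 ∧
      L x z * g = densityCoeff a b x z ∧ L z x = densityCoeff a b z x * g := by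
  obtain ⟨w, hTw, hw, hxw, hwx⟩ := ((eventually_ge_atTop T).and
    ((eventually_isRegular a b).and hx.eventually_densityCoeff_ne_zero)).exists
  have hLwx : L w x ≠ 0 := right_ne_zero_of_mul (h.L_mul_L_loop₂ hT x w ▸ mul_ne_zero hxw hwx)
  refine ⟨L w x / densityCoeff a b w x, div_ne_zero hLwx hwx, ?_⟩
  filter_upwards [eventually_ge_atTop T, hx.eventually_densityCoeff_ne_zero,
    hw.eventually_densityCoeff_ne_zero] with z hTz ⟨hxz, hzx⟩ ⟨_, hzw⟩
  have hloop := h.L_mul_L_loop₂ hT x z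
  have hLxz : L x z ≠ 0 := left_ne_zero_of_mul (hloop ▸ mul_ne_zero hxz hzx)
  have hpath : L w x * L x z = densityCoeff a b w x * densityCoeff a b x z := by
    refine mul_right_cancel₀ hzw ?_
    rw [← h.L_mul_L_mul_L_loop₃ hT, hT.L_eq z w hTz hTw]
  refine ⟨hxz, hzx, ?_, mul_left_cancel₀ hLxz ?_⟩
  · field_simp
    linear_combination hpath
  · rw [← mul_div_assoc, ← mul_div_assoc, eq_div_iff hwx]
    linear_combination densityCoeff a b w x * hloop - densityCoeff a b z x * hpath

theorem IsStructureConstants.exists_rescale_eq (h : IsStructureConstants L I a c 0 0 0)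
    (hT : IsDensityFrom T L I a b c) :
    ∃ g : ℤ → ℂ, (∀ x, g x ≠ 0) ∧ ∀ x y, IsRegular a b x → IsRegular a b y →
      TwistedHV.rescale g L x y = densityCoeff a b x y ∧ TwistedHV.rescale g I x y = c := by
  have hgauge : ∀ x : ℤ, ∃ g : ℂ, g ≠ 0 ∧ (IsRegular a b x → ∀ᶠ z in atTop,
      densityCoeff a b x z ≠ 0 ∧ densityCoeff a b z x ≠ 0 ∧
        L x z * g = densityCoeff a b x z ∧ L z x = densityCoeff a b z x * g) := fun x => by
    by_cases hx : IsRegular a b x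
    · exact (hx.exists_gauge h hT).imp fun g hg => ⟨hg.1, fun _ => hg.2⟩
    · exact ⟨1, one_ne_zero, fun hx' => absurd hx' hx⟩
  choose g hg hgz using hgauge
  refine ⟨g, hg, fun x y hx hy => ?_⟩
  obtain ⟨z, ⟨-, hzx, -, hLzx⟩, hyz, -, hLyz, -⟩ := ((hgz x hx).and (hgz y hy)).exists
  have hL := h.L_mul_L_mul_L_loop₃ hT x y z
  have hI := h.I_mul_L_mul_L_loop₃ hT x y z
  rw [TwistedHV.rescale, TwistedHV.rescale, div_eq_iff (hg y), div_eq_iff (hg y)]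
  constructor <;> refine mul_right_cancel₀ (mul_ne_zero hyz hzx) ?_
  · linear_combination g y * hL - g y * L x y * L y z * hLzx -
      L x y * densityCoeff a b z x * g x * hLyz
  · linear_combination g y * hI - g y * I x y * L y z * hLzx -
      I x y * densityCoeff a b z x * g x * hLyz

end

/-! ### Classification of the structure constants -/

/-- The structure constants after renumbering the basis by `v_x ↦ v_{x + o}`. -/
def shift (o : ℤ) (A : ℤ → ℤ → ℂ) (x y : ℤ) : ℂ := A (x + o) (y + o)

/-- After renumbering and rescaling the basis, the structure constants are those of `k`. -/
def Matches (k : Coeffs) (L I : ℤ → ℤ → ℂ) : Prop :=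
  ∃ (o : ℤ) (g : ℤ → ℂ), (∀ x, g x ≠ 0) ∧ ∀ x y,
    rescale g (shift o L) x y = k.l (y - x) x ∧ rescale g (shift o I) x y = k.i (y - x) x

/-- The seven families of indecomposable modules. -/
inductive IsStandard : Coeffs → Prop
  | modA (a b c : ℂ) : IsStandard (TwistedHV.modA a b c)
  | modAd (a d : ℂ) : IsStandard (TwistedHV.modAd a d)
  | modB (a d : ℂ) : IsStandard (TwistedHV.modB a d)
  | modU (d : ℂ) : IsStandard (TwistedHV.modU d)
  | modV (d : ℂ) : IsStandard (TwistedHV.modV d)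
  | modUtilde {d : ℂ} (hd : d ≠ 0) : IsStandard (TwistedHV.modUtilde d)
  | modVtilde {c : ℂ} (hc : c ≠ 0) : IsStandard (TwistedHV.modVtilde c)

/-- No proper nonempty set of degrees is stable under the action together with its complement. -/
def IsConnected (L I : ℤ → ℤ → ℂ) : Prop :=
  ∀ S : Set ℤ, (∀ x y, L x y ≠ 0 ∨ I x y ≠ 0 → (x ∈ S ↔ y ∈ S)) → S = ∅ ∨ S = Set.univ

/-- The structure constants of the graded dual, in the dual basis numbered by `x ↦ -x`. -/
def dual (A : ℤ → ℤ → ℂ) (x y : ℤ) : ℂ := -A (-y) (-x)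

section Transport

variable {k : Coeffs} {L I : ℤ → ℤ → ℂ} {a c cL cI cLI : ℂ}

theorem Matches.of_rescale_eq {g : ℤ → ℂ} (hg : ∀ x, g x ≠ 0)
    (h : ∀ x y, rescale g L x y = k.l (y - x) x ∧ rescale g I x y = k.i (y - x) x) :
    Matches k L I :=
  ⟨0, g, hg, by simpa only [rescale, shift, add_zero] using h⟩

theorem Matches.of_rescale {g : ℤ → ℂ} (hg : ∀ x, g x ≠ 0)
    (h : Matches k (rescale g L) (rescale g I)) : Matches k L I := by
  obtain ⟨o, f, hf, H⟩ := h
  refine ⟨o, fun x => g (x + o) * f x, fun x => mul_ne_zero (hg _) (hf x), fun x y => ?_⟩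
  rw [← rescale_rescale, ← rescale_rescale]
  exact H x y

theorem Matches.of_shift {o : ℤ} (h : Matches k (shift o L) (shift o I)) : Matches k L I := by
  obtain ⟨p, f, hf, H⟩ := h
  refine ⟨p + o, f, hf, ?_⟩
  simpa only [rescale, shift, ← add_assoc] using H

theorem IsConnected.apply_eq {α : Sort*} {φ : ℤ → α} (h : IsConnected L I)
    (hφ : ∀ x y, L x y ≠ 0 ∨ I x y ≠ 0 → φ x = φ y) (x y : ℤ) : φ x = φ y := by
  have huniv := (h {x | φ x = φ y} fun x' y' hxy => by simp [hφ x' y' hxy]).resolve_left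
    (Set.Nonempty.ne_empty ⟨y, rfl⟩)
  exact Set.eq_univ_iff_forall.mp huniv x

theorem IsConnected.rescale {g : ℤ → ℂ} (hg : ∀ x, g x ≠ 0) (h : IsConnected L I) :
    IsConnected (rescale g L) (rescale g I) := fun S hS => h S fun x y hxy => hS x y <|
  hxy.imp (fun hL => div_ne_zero (mul_ne_zero hL (hg x)) (hg y))
    fun hI => div_ne_zero (mul_ne_zero hI (hg x)) (hg y)

theorem IsConnected.shift (h : IsConnected L I) (o : ℤ) :
    IsConnected (shift o L) (shift o I) := fun S hS => by
  have := h ((Equiv.subRight o) ⁻¹' S) fun x y hxy =>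
    hS (x - o) (y - o) (by simpa [TwistedHV.shift] using hxy)
  simpa [Set.preimage_eq_empty_iff, Set.preimage_eq_univ_iff] using this

theorem IsStructureConstants.shift (h : IsStructureConstants L I a c cL cI cLI) (o : ℤ) :
    IsStructureConstants (shift o L) (shift o I) (a + o) c cL cI cLI where
  L_self x := by
    rw [TwistedHV.shift, h.L_self]
    push_cast
    ring
  I_self x := h.I_self _
  L_mul_L x y y' z e := by
    simpa [TwistedHV.shift] using h.L_mul_L (x + o) (y + o) (y' + o) (z + o) (by omega)
  I_mul_L x y y' z e := by
    simpa [TwistedHV.shift] using h.I_mul_L (x + o) (y + o) (y' + o) (z + o) (by omega)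
  I_mul_I x y y' z e := by
    simpa [TwistedHV.shift] using h.I_mul_I (x + o) (y + o) (y' + o) (z + o) (by omega)

theorem IsStructureConstants.dual (h : IsStructureConstants L I a c 0 0 0) :
    IsStructureConstants (dual L) (dual I) (-a) (-c) 0 0 0 where
  L_self x := by
    rw [TwistedHV.dual, h.L_self]
    push_cast
    ring
  I_self x := by rw [TwistedHV.dual, h.I_self]
  L_mul_L x y y' z e := by
    have := h.L_mul_L (-z) (-y) (-y') (-x) (by omega)
    simp only [mul_zero, ite_self, TwistedHV.dual] at this ⊢
    push_cast at this ⊢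
    linear_combination this
  I_mul_L x y y' z e := by
    have := h.I_mul_L (-z) (-y') (-y) (-x) (by omega)
    have e' : (y : ℂ) + y' = x + z := by exact_mod_cast e
    simp only [mul_zero, ite_self, TwistedHV.dual] at this ⊢
    push_cast at this ⊢
    linear_combination -this + I (-z) (-x) * e'
  I_mul_I x y y' z e := by
    have := h.I_mul_I (-z) (-y) (-y') (-x) (by omega)
    simp only [mul_zero, ite_self, TwistedHV.dual] at this ⊢
    linear_combination this

end Transport

/-- Structure constants which agree with those of `𝒜_{0,0,c}` between nonzero degrees. -/
structure IsModAOffZero (L I : ℤ → ℤ → ℂ) (c : ℂ) : Prop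
    extends IsStructureConstants L I 0 c 0 0 0 where
  L_eq : ∀ x y : ℤ, x ≠ 0 → y ≠ 0 → L x y = x
  I_eq : ∀ x y : ℤ, x ≠ 0 → y ≠ 0 → I x y = c

namespace IsModAOffZero

variable {L I : ℤ → ℤ → ℂ} {c : ℂ} {m n : ℤ}

theorem L_mul_L_zero (h : IsModAOffZero L I c) (hn : n ≠ 0) : L n 0 * L 0 n = 0 := by
  have e := h.L_mul_L n (2 * n) 0 n (by ring)
  rw [h.L_eq n (2 * n) hn (by omega), h.L_eq (2 * n) n (by omega) hn, h.L_eq n n hn hn] at e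
  simp only [mul_zero, ite_self, add_zero] at e
  push_cast at e
  linear_combination -e

theorem L_mul_I_zero (h : IsModAOffZero L I c) (hn : n ≠ 0) : L n 0 * I 0 n = c * n := by
  have e := h.I_mul_L n (2 * n) 0 n (by ring)
  rw [h.I_eq n (2 * n) hn (by omega), h.L_eq (2 * n) n (by omega) hn, h.I_self] at e
  simp only [mul_zero, ite_self, add_zero] at e
  push_cast at e
  linear_combination -e

theorem I_mul_L_zero (h : IsModAOffZero L I c) (hn : n ≠ 0) : I n 0 * L 0 n = 0 := by
  have e := h.I_mul_L n 0 (2 * n) n (by ring)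
  rw [h.L_eq n (2 * n) hn (by omega), h.I_eq (2 * n) n (by omega) hn, h.I_self] at e
  simp only [mul_zero, ite_self, add_zero] at e
  push_cast at e
  linear_combination e

theorem I_mul_I_zero (h : IsModAOffZero L I c) (hn : n ≠ 0) (hm : m ≠ 0) (hnm : n + m ≠ 0)
    (hne : n ≠ m) : I n 0 * I 0 m = c * c := by
  rw [h.I_mul_I_of_ne (y' := n + m) (zero_add _) hne, h.I_eq _ _ hn hnm, h.I_eq _ _ hnm hm]

theorem I_zero_left (h : IsModAOffZero L I c) (hL : ∀ n : ℤ, n ≠ 0 → L 0 n * c = 0) (hn : n ≠ 0) :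
    I 0 n = I 0 1 := by
  rcases eq_or_ne n 1 with rfl | hn1
  · rfl
  have e := h.I_mul_L_of_ne (x := 0) (y := n) (y' := 1 - n) (z := 1) (by ring) (by omega)
  rw [h.L_eq n 1 hn one_ne_zero, h.I_eq _ _ (by omega) one_ne_zero, hL _ (by omega)] at e
  refine mul_left_cancel₀ (Int.cast_ne_zero.mpr hn : (n : ℂ) ≠ 0) ?_
  push_cast at e
  linear_combination e

theorem exists_rescale_eq (h : IsModAOffZero L I c) (hc : c ≠ 0) :
    ∃ g : ℤ → ℂ, (∀ x, g x ≠ 0) ∧ ∀ x y, rescale g L x y = x ∧ rescale g I x y = c := by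
  have hc0 : ∀ {n : ℤ}, n ≠ 0 → c * n ≠ 0 := fun hn => mul_ne_zero hc (Int.cast_ne_zero.mpr hn)
  have hL0 : ∀ n : ℤ, n ≠ 0 → L 0 n = 0 := fun n hn =>
    (mul_eq_zero.mp (h.L_mul_L_zero hn)).resolve_left
      (left_ne_zero_of_mul ((h.L_mul_I_zero hn).trans_ne (hc0 hn)))
  have hI0 : ∀ n : ℤ, n ≠ 0 → I 0 n = I 0 1 := fun n hn =>
    h.I_zero_left (fun m hm => by rw [hL0 m hm, zero_mul]) hn
  have hI01 : I 0 1 ≠ 0 :=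
    right_ne_zero_of_mul ((h.L_mul_I_zero one_ne_zero).trans_ne (hc0 one_ne_zero))
  refine ⟨fun x => if x = 0 then c / I 0 1 else 1, fun x => ?_, fun x y => ?_⟩
  · dsimp only
    split_ifs
    · exact div_ne_zero hc hI01
    · exact one_ne_zero
  rcases eq_or_ne x 0 with rfl | hx <;> rcases eq_or_ne y 0 with rfl | hy
  · simp [rescale, h.L_self, h.I_self, hc, hI01]
  · simp [rescale, hy, hL0 y hy, hI0 y hy, mul_div_cancel₀ c hI01]
  · have hLx := h.L_mul_I_zero hx
    have hIx := h.I_mul_I_zero (m := 2 * x) hx (by omega) (by omega) (by omega)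
    rw [hI0 _ (by omega)] at hLx hIx
    simp only [rescale, if_neg hx, if_pos]
    constructor <;> field_simp
    · linear_combination hLx
    · linear_combination hIx
  · simp [rescale, hx, hy, h.L_eq x y hx hy, h.I_eq x y hx hy]

end IsModAOffZero

/-- The coefficients of `L` and `I` into and out of degree `0`. -/
structure IsGluing (L I : ℤ → ℤ → ℂ) (α β γ δ d e : ℂ) : Prop where
  L_zero_left : ∀ n : ℤ, n ≠ 0 → L 0 n = α * n + β
  L_zero_right : ∀ n : ℤ, n ≠ 0 → L n 0 = n * (γ * n + δ)
  I_zero_left : ∀ n : ℤ, n ≠ 0 → I 0 n = e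
  I_zero_right : ∀ n : ℤ, n ≠ 0 → I n 0 = d * n

theorem IsConnected.not_isGluing_zero {L I : ℤ → ℤ → ℂ} (hcon : IsConnected L I) :
    ¬IsGluing L I 0 0 0 0 0 0 := fun hG => by
  have h01 : ((0 : ℤ) = 0) = ((1 : ℤ) = 0) := hcon.apply_eq (φ := fun x => x = 0)
    (fun x y hxy => by
      rcases eq_or_ne x 0 with rfl | hx <;> rcases eq_or_ne y 0 with rfl | hy
      · rfl
      · simp [hG.L_zero_left y hy, hG.I_zero_left y hy] at hxy
      · simp [hG.L_zero_right x hx, hG.I_zero_right x hx] at hxy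
      · simp [hx, hy]) 0 1
  simp at h01

namespace IsModAOffZero

variable {L I : ℤ → ℤ → ℂ} {α β γ δ d e : ℂ}

theorem exists_L_zero_left (h : IsModAOffZero L I 0) :
    ∃ α β : ℂ, ∀ n : ℤ, n ≠ 0 → L 0 n = α * n + β :=
  exists_eq_affine fun n m hn hm hnm => by
    have e := h.L_mul_L_of_ne (x := 0) (y := n) (y' := m) (z := n + m) (by ring) hnm.symm
    rw [h.L_eq _ _ hn hnm, h.L_eq _ _ hm hnm] at e
    linear_combination e

theorem exists_L_zero_right (h : IsModAOffZero L I 0) :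
    ∃ γ δ : ℂ, ∀ n : ℤ, n ≠ 0 → L n 0 = n * (γ * n + δ) := by
  obtain ⟨γ, δ, hγδ⟩ := exists_eq_affine (φ := fun n => L n 0 / n) fun n m hn hm hnm => by
    have e := h.L_mul_L_of_ne (x := n + m) (y := n) (y' := m) (z := 0) (by ring) hnm
    rw [h.L_eq _ _ hnm hn, h.L_eq _ _ hnm hm] at e
    have hnm' : (n : ℂ) + m ≠ 0 := by exact_mod_cast hnm
    push_cast at e ⊢
    field_simp
    linear_combination e
  refine ⟨γ, δ, fun n hn => ?_⟩
  rw [← hγδ n hn, mul_div_cancel₀ _ (Int.cast_ne_zero.mpr hn)]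

theorem exists_I_zero_right (h : IsModAOffZero L I 0) :
    ∃ d : ℂ, ∀ n : ℤ, n ≠ 0 → I n 0 = d * n := by
  refine ⟨-I (-1) 0, fun n hn => ?_⟩
  rcases eq_or_ne n (-1) with rfl | hn1
  · push_cast
    ring
  have e := h.I_mul_L_of_ne (x := n) (y := n + 1) (y' := -1) (z := 0) (by ring) hn
  rw [h.I_eq _ _ hn (by omega), h.L_eq _ _ hn (by omega)] at e
  push_cast at e
  linear_combination -e

theorem exists_isGluing (h : IsModAOffZero L I 0) : ∃ α β γ δ d e, IsGluing L I α β γ δ d e := by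
  obtain ⟨α, β, hαβ⟩ := h.exists_L_zero_left
  obtain ⟨γ, δ, hγδ⟩ := h.exists_L_zero_right
  obtain ⟨d, hd⟩ := h.exists_I_zero_right
  exact ⟨α, β, γ, δ, d, I 0 1, hαβ, hγδ, fun n => h.I_zero_left fun _ _ => mul_zero _, hd⟩

theorem gluing_relations (h : IsModAOffZero L I 0) (hG : IsGluing L I α β γ δ d e) :
    ((α = 0 ∧ β = 0) ∨ (γ = 0 ∧ δ = 0)) ∧ (d = 0 ∨ e = 0) ∧
      (d = 0 ∨ (α = 0 ∧ β = 0)) ∧ (e = 0 ∨ (γ = 0 ∧ δ = 0)) := by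
  have cancel : ∀ {n : ℤ} {r : ℂ}, n ≠ 0 → n * r = 0 → r = 0 := fun hn hr =>
    (mul_eq_zero.mp hr).resolve_left (Int.cast_ne_zero.mpr hn)
  refine ⟨affine_eq_zero_or_of_mul_eq_zero fun n hn => cancel hn ?_, ?_, ?_, ?_⟩
  · have hLL := h.L_mul_L_zero hn
    rw [hG.L_zero_left n hn, hG.L_zero_right n hn] at hLL
    linear_combination hLL
  · have hII := h.I_mul_I_zero (n := 1) (m := 2) (by omega) (by omega) (by omega) (by omega)
    rw [hG.I_zero_right 1 (by omega), hG.I_zero_left 2 (by omega)] at hII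
    simpa using hII
  · refine (affine_eq_zero_or_of_mul_eq_zero (α := 0) fun n hn => cancel hn ?_).imp_left And.right
    have hIL := h.I_mul_L_zero hn
    rw [hG.L_zero_left n hn, hG.I_zero_right n hn] at hIL
    linear_combination hIL
  · refine (affine_eq_zero_or_of_mul_eq_zero (α := 0) fun n hn => cancel hn ?_).imp_left And.right
    have hLI := h.L_mul_I_zero hn
    rw [hG.L_zero_right n hn, hG.I_zero_left n hn] at hLI
    linear_combination hLI

theorem matches_of_isGluing (h : IsModAOffZero L I 0) (hG : IsGluing L I α β γ δ d e)
    {k : Coeffs} {g : ℤ → ℂ} (hg : ∀ x, g x ≠ 0) (hself : k.l 0 0 = 0 ∧ k.i 0 0 = 0)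
    (hne : ∀ x y : ℤ, x ≠ 0 → y ≠ 0 → x * g x / g y = k.l (y - x) x ∧ 0 = k.i (y - x) x)
    (hleft : ∀ n : ℤ, n ≠ 0 →
      (α * n + β) * g 0 / g n = k.l n 0 ∧ e * g 0 / g n = k.i n 0)
    (hright : ∀ n : ℤ, n ≠ 0 →
      n * (γ * n + δ) * g n / g 0 = k.l (-n) n ∧ d * n * g n / g 0 = k.i (-n) n) :
    Matches k L I := by
  refine .of_rescale_eq hg fun x y => ?_
  simp only [rescale]
  rcases eq_or_ne x 0 with rfl | hx <;> rcases eq_or_ne y 0 with rfl | hy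
  · simp [h.L_self, h.I_self, hself]
  · rw [sub_zero, hG.L_zero_left y hy, hG.I_zero_left y hy]
    exact hleft y hy
  · rw [zero_sub, hG.L_zero_right x hx, hG.I_zero_right x hx]
    exact hright x hx
  · rw [h.L_eq x y hx hy, h.I_eq x y hx hy, zero_mul, zero_div]
    exact hne x y hx hy

theorem exists_matches_of_L_zero_left_ne (h : IsModAOffZero L I 0)
    (hG : IsGluing L I α β 0 0 0 e) (hne : ¬(α = 0 ∧ β = 0)) :
    ∃ k, IsStandard k ∧ Matches k L I := by
  have hg : ∀ {w : ℂ}, w ≠ 0 → ∀ x : ℤ, (if x = 0 then w⁻¹ else (x : ℂ)⁻¹) ≠ 0 := fun hw x => by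
    split_ifs with hx
    · exact inv_ne_zero hw
    · exact inv_ne_zero (Int.cast_ne_zero.mpr hx)
  rcases eq_or_ne α 0 with rfl | hα
  · have hβ : β ≠ 0 := fun hβ => hne ⟨rfl, hβ⟩
    refine ⟨_, .modV (e / β), h.matches_of_isGluing hG (hg hβ) ?_ ?_ ?_ ?_⟩ <;>
      simp +contextual [modV, hβ, div_eq_mul_inv]
  · refine ⟨_, .modAd (β / α) (e / α), h.matches_of_isGluing hG (hg hα) ?_ ?_ (fun n hn => ?_) ?_⟩
    · simp [modAd]
    · simp +contextual [modAd, div_eq_mul_inv]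
    · simp only [modAd, if_pos, if_neg hn]
      constructor <;> field_simp
    · simp +contextual [modAd, div_eq_mul_inv]

theorem exists_matches_of_L_zero_right_ne (h : IsModAOffZero L I 0)
    (hG : IsGluing L I 0 0 γ δ d 0) (hne : ¬(γ = 0 ∧ δ = 0)) :
    ∃ k, IsStandard k ∧ Matches k L I := by
  have hg : ∀ {w : ℂ}, w ≠ 0 → ∀ x : ℤ, (if x = 0 then w else 1) ≠ 0 := fun hw x => by
    split_ifs
    · exact hw
    · exact one_ne_zero
  rcases eq_or_ne γ 0 with rfl | hγ
  · have hδ : δ ≠ 0 := fun hδ => hne ⟨rfl, hδ⟩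
    refine ⟨_, .modU (-d / δ), h.matches_of_isGluing hG (hg hδ) ?_ ?_ ?_ (fun n hn => ?_)⟩
    · simp [modU]
    · simp +contextual [modU]
    · simp +contextual [modU]
    · simp only [modU, if_pos, if_neg hn, neg_add_cancel]
      push_cast
      constructor <;> field_simp
      ring
  · refine ⟨_, .modB (-δ / γ) (d / γ),
      h.matches_of_isGluing hG (hg (neg_ne_zero.mpr hγ)) ?_ ?_ ?_ (fun n hn => ?_)⟩
    · simp [modB]
    · simp +contextual [modB]
    · simp +contextual [modB]
    · simp only [modB, if_pos, if_neg hn, neg_add_cancel]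
      push_cast
      constructor <;> field_simp
      ring

theorem exists_matches (h : IsModAOffZero L I 0) (hcon : IsConnected L I) :
    ∃ k, IsStandard k ∧ Matches k L I := by
  obtain ⟨α, β, γ, δ, d, e, hG⟩ := h.exists_isGluing
  obtain ⟨hLL, hII, hIL, hLI⟩ := h.gluing_relations hG
  by_cases hαβ : α = 0 ∧ β = 0
  · by_cases hγδ : γ = 0 ∧ δ = 0
    · obtain ⟨⟨rfl, rfl⟩, rfl, rfl⟩ := And.intro hαβ hγδ
      rcases eq_or_ne d 0 with rfl | hd
      · have he : e ≠ 0 := by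
          rintro rfl
          exact hcon.not_isGluing_zero hG
        refine ⟨_, .modVtilde he, h.matches_of_isGluing hG (g := 1) (fun _ => one_ne_zero)
          ?_ ?_ ?_ ?_⟩ <;> simp +contextual [modVtilde]
      · obtain rfl := hII.resolve_left hd
        refine ⟨_, .modUtilde (neg_ne_zero.mpr hd), h.matches_of_isGluing hG (g := 1)
          (fun _ => one_ne_zero) ?_ ?_ ?_ ?_⟩ <;> simp +contextual [modUtilde]
    · obtain ⟨rfl, rfl⟩ := hαβ
      obtain rfl := hLI.resolve_right hγδ
      exact h.exists_matches_of_L_zero_right_ne hG hγδ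
  · obtain ⟨rfl, rfl⟩ := hLL.resolve_left hαβ
    obtain rfl := hIL.resolve_right hαβ
    exact h.exists_matches_of_L_zero_left_ne hG hαβ

end IsModAOffZero

namespace IsStructureConstants

variable {L I : ℤ → ℤ → ℂ} {a b c cL cI cLI : ℂ}

theorem matches_modA_one (h : IsStructureConstants L I 0 c 0 0 0) (hc : c ≠ 0)
    (hL : ∀ x y : ℤ, x ≠ 0 → y ≠ 0 → L x y = y) (hI : ∀ x y : ℤ, x ≠ 0 → y ≠ 0 → I x y = c) :
    Matches (modA 0 1 c) L I := by
  have hdual : IsModAOffZero (TwistedHV.dual L) (TwistedHV.dual I) (-c) :=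
    { neg_zero (G := ℂ) ▸ h.dual with
      L_eq := fun x y hx hy => by
        simp [TwistedHV.dual, hL _ _ (neg_ne_zero.mpr hy) (neg_ne_zero.mpr hx)]
      I_eq := fun x y hx hy => by
        rw [TwistedHV.dual, hI _ _ (neg_ne_zero.mpr hy) (neg_ne_zero.mpr hx)] }
  obtain ⟨g, hg, hgLI⟩ := hdual.exists_rescale_eq (neg_ne_zero.mpr hc)
  refine .of_rescale_eq (g := fun x => (g (-x))⁻¹) (fun x => inv_ne_zero (hg _)) fun x y => ?_
  obtain ⟨hL', hI'⟩ := hgLI (-y) (-x)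
  have := hg (-x)
  have := hg (-y)
  simp only [TwistedHV.rescale, TwistedHV.dual, neg_neg, modA] at hL' hI' ⊢
  push_cast at hL' ⊢
  field_simp at hL' hI' ⊢
  exact ⟨by linear_combination -hL', by linear_combination -hI'⟩

/-- Rescaling `v_x` by `x` turns `𝒜_{0,1,0}` into `𝒜_{0,0,0}` between nonzero degrees. -/
theorem exists_matches_of_one (h : IsStructureConstants L I 0 0 0 0 0) (hcon : IsConnected L I)
    (hL : ∀ x y : ℤ, x ≠ 0 → y ≠ 0 → L x y = y) (hI : ∀ x y : ℤ, x ≠ 0 → y ≠ 0 → I x y = 0) :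
    ∃ k, IsStandard k ∧ Matches k L I := by
  have hg : ∀ x : ℤ, (if x = 0 then 1 else (x : ℂ)) ≠ 0 := fun x => by
    split_ifs with hx
    · exact one_ne_zero
    · exact Int.cast_ne_zero.mpr hx
  have hzero : IsModAOffZero (TwistedHV.rescale _ L) (TwistedHV.rescale _ I) 0 :=
    { h.rescale hg with
      L_eq := fun x y hx hy => by
        rw [TwistedHV.rescale, hL x y hx hy, if_neg hx, if_neg hy,
          mul_div_cancel_left₀ _ (Int.cast_ne_zero.mpr hy)]
      I_eq := fun x y hx hy => by rw [TwistedHV.rescale, hI x y hx hy, zero_mul, zero_div] }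
  exact (hzero.exists_matches (hcon.rescale hg)).imp fun k hk => hk.imp_right (.of_rescale hg)

theorem exists_matches_of_off_zero (h : IsStructureConstants L I 0 c 0 0 0)
    (hcon : IsConnected L I) (hb : b * (1 - b) = 0)
    (hLI : ∀ x y : ℤ, x ≠ 0 → y ≠ 0 → L x y = densityCoeff 0 b x y ∧ I x y = c) :
    ∃ k, IsStandard k ∧ Matches k L I := by
  have hI : ∀ x y : ℤ, x ≠ 0 → y ≠ 0 → I x y = c := fun x y hx hy => (hLI x y hx hy).2
  rcases mul_eq_zero.mp hb with rfl | hb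
  · have hzero : IsModAOffZero L I c :=
      { h with L_eq := fun x y hx hy => by simp [(hLI x y hx hy).1, densityCoeff], I_eq := hI }
    rcases eq_or_ne c 0 with rfl | hc
    · exact hzero.exists_matches hcon
    · obtain ⟨g, hg, hgLI⟩ := hzero.exists_rescale_eq hc
      exact ⟨_, .modA 0 0 c, .of_rescale_eq hg fun x y => by simpa [modA] using hgLI x y⟩
  · obtain rfl : b = 1 := (sub_eq_zero.mp hb).symm
    have hL : ∀ x y : ℤ, x ≠ 0 → y ≠ 0 → L x y = y := fun x y hx hy => by
      simp [(hLI x y hx hy).1, densityCoeff]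
    rcases eq_or_ne c 0 with rfl | hc
    · exact h.exists_matches_of_one hcon hL hI
    · exact ⟨_, .modA 0 1 c, h.matches_modA_one hc hL hI⟩

theorem exists_matches_of_regular (h : IsStructureConstants L I a c 0 0 0)
    (hcon : IsConnected L I) (hLI : ∀ x y : ℤ, IsRegular a b x → IsRegular a b y →
      L x y = densityCoeff a b x y ∧ I x y = c) :
    ∃ k, IsStandard k ∧ Matches k L I := by
  by_cases hreg : ∀ x : ℤ, IsRegular a b x
  · refine ⟨_, .modA a b c, .of_rescale_eq (g := 1) (fun _ => one_ne_zero) fun x y => ?_⟩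
    simp [TwistedHV.rescale, modA, hLI x y (hreg x) (hreg y), densityCoeff]
  simp only [IsRegular, not_forall, not_or, not_not] at hreg
  obtain ⟨o, hb, ho⟩ := hreg
  have hreg : ∀ x : ℤ, x ≠ 0 → IsRegular a b (x + o) := fun x hx => .inr <| by
    push_cast
    rw [add_left_comm, ho, add_zero]
    exact Int.cast_ne_zero.mpr hx
  have hshift := (ho ▸ h.shift o).exists_matches_of_off_zero (hcon.shift o) hb fun x y hx hy => by
    obtain ⟨hL, hI⟩ := hLI _ _ (hreg x hx) (hreg y hy)
    refine ⟨?_, hI⟩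
    rw [TwistedHV.shift, hL, densityCoeff, densityCoeff]
    push_cast
    linear_combination ho
  exact hshift.imp fun k hk => hk.imp_right .of_shift

theorem exists_matches (h : IsStructureConstants L I a c cL cI cLI) (hcon : IsConnected L I) :
    cL = 0 ∧ cI = 0 ∧ cLI = 0 ∧ ∃ k, IsStandard k ∧ Matches k L I := by
  obtain ⟨rfl, rfl, rfl, b, g, hg, T, hT⟩ := h.exists_rescale_isDensityFrom
  obtain ⟨g', hg', hreg⟩ := (h.rescale hg).exists_rescale_eq hT
  refine ⟨rfl, rfl, rfl, ?_⟩
  exact (((h.rescale hg).rescale hg').exists_matches_of_regular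
    ((hcon.rescale hg).rescale hg') hreg).imp fun k hk =>
      hk.imp_right fun hm => .of_rescale hg (.of_rescale hg' hm)

end IsStructureConstants

/-! ### From modules to structure constants -/

section Module

variable {V : Type*} [AddCommGroup V] [LieRingModule HV V]

theorem lie_genBracket (g h : Gen) (u : V) :
    ⁅genBracket g h, u⁆ = ⁅gen g, ⁅gen h, u⁆⁆ - ⁅gen h, ⁅gen g, u⁆⁆ := by
  rw [← lie_lie]
  exact congrArg (⁅·, u⁆) (bracketMap_gen g h).symm

variable [Module ℂ V]

/-- `L` and `I` are the structure constants of the action in the basis `v`, and `cL x`, `cI x`,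
`cLI x` are the scalars by which the central elements act on `v x`. -/
structure ActsBy (v : Module.Basis ℤ ℂ V) (L I : ℤ → ℤ → ℂ) (cL cI cLI : ℤ → ℂ) : Prop where
  lie_L : ∀ n x, ⁅gen (.L n), v x⁆ = L x (n + x) • v (n + x)
  lie_I : ∀ n x, ⁅gen (.I n), v x⁆ = I x (n + x) • v (n + x)
  lie_CL : ∀ x, ⁅gen .CL, v x⁆ = cL x • v x
  lie_CI : ∀ x, ⁅gen .CI, v x⁆ = cI x • v x
  lie_CLI : ∀ x, ⁅gen .CLI, v x⁆ = cLI x • v x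

theorem exists_actsBy (v : Module.Basis ℤ ℂ V)
    (hgr : ∀ m n : ℤ, ∀ x ∈ component m, ⁅x, v n⁆ ∈ Submodule.span ℂ {v (m + n)}) :
    ∃ L I cL cI cLI, ActsBy v L I cL cI cLI := by
  have hcoeff : ∀ (g : Gen) (m : ℤ), gen g ∈ component m → ∀ x,
      ∃ r : ℂ, ⁅gen g, v x⁆ = r • v (m + x) := fun g m hg x =>
    (Submodule.mem_span_singleton.mp (hgr m x _ hg)).imp fun _ => Eq.symm
  choose L hL using fun m => hcoeff (.L m) m (Submodule.subset_span (by simp))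
  choose I hI using fun m => hcoeff (.I m) m (Submodule.subset_span (by simp))
  choose cL hcL using hcoeff .CL 0 (Submodule.subset_span (by simp))
  choose cI hcI using hcoeff .CI 0 (Submodule.subset_span (by simp))
  choose cLI hcLI using hcoeff .CLI 0 (Submodule.subset_span (by simp))
  simp only [zero_add] at hcL hcI hcLI
  exact ⟨fun x y => L (y - x) x, fun x y => I (y - x) x, cL, cI, cLI,
    fun n x => by rw [hL, add_sub_cancel_right], fun n x => by rw [hI, add_sub_cancel_right],
    hcL, hcI, hcLI⟩

namespace ActsBy

variable {v : Module.Basis ℤ ℂ V} {L I : ℤ → ℤ → ℂ} {cL cI cLI : ℤ → ℂ} {n x y : ℤ}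

theorem lie_L_of_eq (h : ActsBy v L I cL cI cLI) (e : n + x = y) :
    ⁅gen (.L n), v x⁆ = L x y • v y := e ▸ h.lie_L n x

theorem lie_I_of_eq (h : ActsBy v L I cL cI cLI) (e : n + x = y) :
    ⁅gen (.I n), v x⁆ = I x y • v y := e ▸ h.lie_I n x

theorem lie_gen_mem_span (h : ActsBy v L I cL cI cLI) {S : Set ℤ}
    (hS : ∀ x y, L x y ≠ 0 ∨ I x y ≠ 0 → x ∈ S → y ∈ S) (g : Gen) :
    ∀ u ∈ v '' S, ⁅gen g, u⁆ ∈ Submodule.span ℂ (v '' S) := by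
  rintro _ ⟨x, hx, rfl⟩
  have smul_mem : ∀ {r : ℂ} {y : ℤ}, (r ≠ 0 → y ∈ S) → r • v y ∈ Submodule.span ℂ (v '' S) :=
    fun {r y} hy => by
      rcases eq_or_ne r 0 with rfl | hr
      · simp
      · exact Submodule.smul_mem _ _ (Submodule.subset_span ⟨y, hy hr, rfl⟩)
  cases g with
  | L n => exact h.lie_L n x ▸ smul_mem fun hL => hS _ _ (.inl hL) hx
  | I n => exact h.lie_I n x ▸ smul_mem fun hI => hS _ _ (.inr hI) hx
  | CL => exact h.lie_CL x ▸ smul_mem fun _ => hx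
  | CI => exact h.lie_CI x ▸ smul_mem fun _ => hx
  | CLI => exact h.lie_CLI x ▸ smul_mem fun _ => hx

end ActsBy

variable [LieModule ℂ HV V]

theorem lie_genBracket_of_smul {g h : Gen} {u w w' t : V} {r s r' s' : ℂ}
    (hu : ⁅gen h, u⁆ = r • w) (hw : ⁅gen g, w⁆ = s • t)
    (hu' : ⁅gen g, u⁆ = r' • w') (hw' : ⁅gen h, w'⁆ = s' • t) :
    ⁅genBracket g h, u⁆ = (r * s - r' * s') • t := by
  rw [lie_genBracket, hu, hu', lie_smul, lie_smul, hw, hw', smul_smul, smul_smul, sub_smul]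

theorem lie_ite_smul_gen {g : Gen} {v : ℤ → V} {f : ℤ → ℂ}
    (hg : ∀ x, ⁅gen g, v x⁆ = f x • v x) (r : ℂ) (x z : ℤ) :
    ⁅if z - x = 0 then r • gen g else 0, v x⁆ = (if x = z then r * f x else 0) • v z := by
  rcases eq_or_ne x z with rfl | hxz
  · rw [if_pos (sub_self x), if_pos rfl, smul_lie, hg, smul_smul]
  · rw [if_neg (sub_ne_zero.mpr hxz.symm), if_neg hxz, zero_lie, zero_smul]

namespace ActsBy

variable {v : Module.Basis ℤ ℂ V} {L I : ℤ → ℤ → ℂ} {cL cI cLI : ℤ → ℂ} {x y y' z : ℤ}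

theorem L_mul_L (h : ActsBy v L I cL cI cLI) (e : y + y' = x + z) :
    L x y * L y z - L x y' * L y' z = ((y : ℂ) - y') * L x z +
      if x = z then (((y' : ℂ) - x) ^ 3 - (y' - x)) / 12 * cL x else 0 := by
  have hbr : ⁅genBracket (.L (y' - x)) (.L (y - x)), v x⁆ = _ :=
    lie_genBracket_of_smul (h.lie_L_of_eq (sub_add_cancel y x))
      (h.lie_L_of_eq (y := z) (by omega)) (h.lie_L_of_eq (sub_add_cancel y' x))
      (h.lie_L_of_eq (by omega))
  rw [genBracket, show y' - x + (y - x) = z - x by omega, add_lie, smul_lie,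
    h.lie_L_of_eq (sub_add_cancel z x), lie_ite_smul_gen h.lie_CL, smul_smul, ← add_smul] at hbr
  rw [← smul_left_injective ℂ (v.ne_zero z) hbr]
  push_cast
  ring

theorem I_mul_L (h : ActsBy v L I cL cI cLI) (e : y + y' = x + z) :
    I x y * L y z - L x y' * I y' z = ((y : ℂ) - x) * I x z +
      if x = z then (((y' : ℂ) - x) ^ 2 - (y' - x)) * cLI x else 0 := by
  have hbr : ⁅genBracket (.L (y' - x)) (.I (y - x)), v x⁆ = _ :=
    lie_genBracket_of_smul (h.lie_I_of_eq (sub_add_cancel y x))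
      (h.lie_L_of_eq (y := z) (by omega)) (h.lie_L_of_eq (sub_add_cancel y' x))
      (h.lie_I_of_eq (by omega))
  rw [genBracket, show y' - x + (y - x) = z - x by omega, add_lie, smul_lie,
    h.lie_I_of_eq (sub_add_cancel z x), lie_ite_smul_gen h.lie_CLI, smul_smul, ← add_smul] at hbr
  rw [← smul_left_injective ℂ (v.ne_zero z) hbr]
  push_cast
  rfl

theorem I_mul_I (h : ActsBy v L I cL cI cLI) (e : y + y' = x + z) :
    I x y * I y z - I x y' * I y' z = if x = z then ((y : ℂ) - x) * cI x else 0 := by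
  have hbr : ⁅genBracket (.I (y' - x)) (.I (y - x)), v x⁆ = _ :=
    lie_genBracket_of_smul (h.lie_I_of_eq (sub_add_cancel y x))
      (h.lie_I_of_eq (y := z) (by omega)) (h.lie_I_of_eq (sub_add_cancel y' x))
      (h.lie_I_of_eq (by omega))
  rw [genBracket, show y' - x + (y - x) = z - x by omega, lie_ite_smul_gen h.lie_CI] at hbr
  rw [← smul_left_injective ℂ (v.ne_zero z) hbr]
  push_cast
  rfl

theorem apply_eq_of_genBracket_eq_zero (h : ActsBy v L I cL cI cLI) (hcon : IsConnected L I)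
    {g : Gen} {f : ℤ → ℂ} (hf : ∀ x, ⁅gen g, v x⁆ = f x • v x) (hg : ∀ g', genBracket g g' = 0)
    (x : ℤ) : f x = f 0 := by
  have of_smul : ∀ {g' : Gen} {x y : ℤ} {r : ℂ}, r ≠ 0 → ⁅gen g', v x⁆ = r • v y → f x = f y :=
    fun {g' x y r} hr hg' => by
      have hbr := lie_genBracket_of_smul hg' (hf y) (hf x) hg'
      rw [hg, zero_lie, eq_comm, smul_eq_zero_iff_left (v.ne_zero y)] at hbr
      exact mul_left_cancel₀ hr (by linear_combination -hbr)
  exact hcon.apply_eq (fun x y hxy => hxy.elim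
    (fun hL => of_smul hL (h.lie_L_of_eq (sub_add_cancel y x)))
    fun hI => of_smul hI (h.lie_I_of_eq (sub_add_cancel y x))) x 0

theorem L_self (h : ActsBy v L I cL cI cLI) (hcon : IsConnected L I) (x : ℤ) :
    L x x = L 0 0 + x := by
  have hconst : L x x - x = L 0 0 - (0 : ℤ) := hcon.apply_eq (φ := fun x => L x x - x)
    (fun x y hxy => by
      rcases hxy with hxy | hxy
      · refine mul_left_cancel₀ hxy ?_
        have e := h.L_mul_L (add_comm y x)
        simp only [sub_self, ne_eq, OfNat.ofNat_ne_zero, not_false_eq_true, zero_pow, zero_div,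
          zero_mul, ite_self, add_zero] at e
        linear_combination -e
      · refine mul_left_cancel₀ hxy ?_
        have e := h.I_mul_L (add_comm y x)
        simp only [sub_self, ne_eq, OfNat.ofNat_ne_zero, not_false_eq_true, zero_pow,
          zero_mul, ite_self, add_zero] at e
        linear_combination -e) x 0
  push_cast at hconst
  linear_combination hconst

theorem isStructureConstants (h : ActsBy v L I cL cI cLI) (hcon : IsConnected L I) :
    IsStructureConstants L I (L 0 0) (I 0 0) (cL 0) (cI 0) (cLI 0) where
  L_self := h.L_self hcon
  I_self := h.apply_eq_of_genBracket_eq_zero hcon (g := .I 0) (f := fun x => I x x)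
    (fun _ => h.lie_I_of_eq (zero_add _)) fun g => by cases g <;> simp +contextual [genBracket]
  L_mul_L x y y' z e := by
    rw [h.L_mul_L e, h.apply_eq_of_genBracket_eq_zero hcon h.lie_CL fun _ => rfl]
  I_mul_L x y y' z e := by
    rw [h.I_mul_L e, h.apply_eq_of_genBracket_eq_zero hcon h.lie_CLI fun _ => rfl]
  I_mul_I x y y' z e := by
    rw [h.I_mul_I e, h.apply_eq_of_genBracket_eq_zero hcon h.lie_CI fun _ => rfl]

end ActsBy

/-- The submodule spanned by a set which the standard basis of the algebra maps into its span. -/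
def spanSubmodule (s : Set V) (hs : ∀ g, ∀ u ∈ s, ⁅gen g, u⁆ ∈ Submodule.span ℂ s) :
    LieSubmodule ℂ HV V where
  toSubmodule := Submodule.span ℂ s
  lie_mem {x u} hu := by
    induction x using gen_induction with
    | zero => simp
    | add x x' hx hx' => exact add_lie x x' u ▸ Submodule.add_mem _ hx hx'
    | smul r g =>
      have hle : Submodule.span ℂ s ≤
          (Submodule.span ℂ s).comap (LieModule.toEnd ℂ HV V (gen g)) :=
        Submodule.span_le.mpr (hs g)
      exact smul_lie r (gen g) u ▸ Submodule.smul_mem _ r (hle hu)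

theorem Indecomposable.eq_empty_or_univ {ι : Type*} (hind : Indecomposable V)
    (v : Module.Basis ι ℂ V) (S : Set ι)
    (hS : ∀ g, ∀ u ∈ v '' S, ⁅gen g, u⁆ ∈ Submodule.span ℂ (v '' S))
    (hSc : ∀ g, ∀ u ∈ v '' Sᶜ, ⁅gen g, u⁆ ∈ Submodule.span ℂ (v '' Sᶜ)) :
    S = ∅ ∨ S = Set.univ := by
  have hcompl : IsCompl (spanSubmodule _ hS) (spanSubmodule _ hSc) := by
    rw [← LieSubmodule.isCompl_toSubmodule]
    refine ⟨v.linearIndependent.disjoint_span_image disjoint_compl_right, ?_⟩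
    rw [codisjoint_iff]
    change Submodule.span ℂ (v '' S) ⊔ Submodule.span ℂ (v '' Sᶜ) = ⊤
    rw [← Submodule.span_union, ← Set.image_union, Set.union_compl_self, Set.image_univ, v.span_eq]
  have eq_empty : ∀ (S : Set ι) hS, spanSubmodule (v '' S) hS = ⊥ → S = ∅ := fun S hS hbot =>
    Set.eq_empty_iff_forall_notMem.mpr fun x hx => v.ne_zero x <| by
      have hmem : v x ∈ spanSubmodule (v '' S) hS := Submodule.subset_span ⟨x, hx, rfl⟩
      rwa [hbot, LieSubmodule.mem_bot] at hmem
  exact (hind.2 _ _ hcompl).imp (eq_empty _ _) fun h => Set.compl_empty_iff.mp (eq_empty _ _ h)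

theorem ActsBy.isConnected {v : Module.Basis ℤ ℂ V} {L I : ℤ → ℤ → ℂ} {cL cI cLI : ℤ → ℂ}
    (h : ActsBy v L I cL cI cLI) (hind : Indecomposable V) : IsConnected L I :=
  fun S hS => hind.eq_empty_or_univ v S (h.lie_gen_mem_span fun x y hxy => (hS x y hxy).mp)
    (h.lie_gen_mem_span fun x y hxy => mt (hS x y hxy).mpr)

/-! ### From structure constants to modules -/

theorem map_lie_of_gen {ι W : Type*} [AddCommGroup W] [Module ℂ W] [LieRingModule HV W]
    [LieModule ℂ HV W] (v : Module.Basis ι ℂ V) (f : V →ₗ[ℂ] W)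
    (hf : ∀ g i, f ⁅gen g, v i⁆ = ⁅gen g, f (v i)⁆) (x : HV) (u : V) : f ⁅x, u⁆ = ⁅x, f u⁆ := by
  induction x using gen_induction with
  | zero => simp
  | add x x' hx hx' => rw [add_lie, map_add, hx, hx', add_lie]
  | smul r g =>
    have hg : f ∘ₗ LieModule.toEnd ℂ HV V (gen g) = LieModule.toEnd ℂ HV W (gen g) ∘ₗ f :=
      v.ext (hf g)
    rw [smul_lie, map_smul, smul_lie]
    exact congrArg (r • ·) (LinearMap.congr_fun hg u)

theorem Coeffs.lie_gen (k : Coeffs) (g : Gen) (u : k.Mod) : ⁅gen g, u⁆ = k.genAct g u :=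
  LinearMap.congr_fun (k.act_gen g) u

theorem Coeffs.nonempty_equiv {k : Coeffs} {v : Module.Basis ℤ ℂ V}
    (h : ActsBy v (fun x y => k.l (y - x) x) (fun x y => k.i (y - x) x) 0 0 0) :
    Nonempty (V ≃ₗ⁅ℂ,HV⁆ k.Mod) := by
  let e : V ≃ₗ[ℂ] k.Mod := v.repr
  have he : ∀ x, e (v x) = k.vec x := v.repr_self
  refine ⟨{ e with map_lie' := fun {x u} => map_lie_of_gen v e.toLinearMap (fun g x => ?_) x u }⟩
  change e ⁅gen g, v x⁆ = ⁅gen g, e (v x)⁆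
  rw [k.lie_gen, he]
  cases g with
  | L n =>
    rw [h.lie_L, map_smul, he, add_sub_cancel_right, Coeffs.genAct, k.lift_vec]
  | I n =>
    rw [h.lie_I, map_smul, he, add_sub_cancel_right, Coeffs.genAct, k.lift_vec]
  | CL => rw [h.lie_CL, Pi.zero_apply, zero_smul, map_zero]; rfl
  | CI => rw [h.lie_CI, Pi.zero_apply, zero_smul, map_zero]; rfl
  | CLI => rw [h.lie_CLI, Pi.zero_apply, zero_smul, map_zero]; rfl

theorem ActsBy.smul_shift {v w : Module.Basis ℤ ℂ V} {L I : ℤ → ℤ → ℂ} {cL cI cLI : ℤ → ℂ}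
    (h : ActsBy v L I cL cI cLI) {g : ℤ → ℂ} (hg : ∀ x, g x ≠ 0) {o : ℤ}
    (hw : ∀ x, w x = g x • v (x + o)) :
    ActsBy w (rescale g (shift o L)) (rescale g (shift o I)) (fun x => cL (x + o))
      (fun x => cI (x + o)) (fun x => cLI (x + o)) where
  lie_L n x := by
    rw [hw, hw, lie_smul, h.lie_L, smul_smul, smul_smul, rescale, shift, ← add_assoc,
      div_mul_cancel₀ _ (hg _), mul_comm]
  lie_I n x := by
    rw [hw, hw, lie_smul, h.lie_I, smul_smul, smul_smul, rescale, shift, ← add_assoc,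
      div_mul_cancel₀ _ (hg _), mul_comm]
  lie_CL x := by rw [hw, lie_smul, h.lie_CL, smul_comm]
  lie_CI x := by rw [hw, lie_smul, h.lie_CI, smul_comm]
  lie_CLI x := by rw [hw, lie_smul, h.lie_CLI, smul_comm]

theorem ActsBy.nonempty_equiv_of_matches {v : Module.Basis ℤ ℂ V} {L I : ℤ → ℤ → ℂ}
    (h : ActsBy v L I 0 0 0) {k : Coeffs} (hk : Matches k L I) :
    Nonempty (V ≃ₗ⁅ℂ,HV⁆ k.Mod) := by
  obtain ⟨o, g, hg, hLI⟩ := hk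
  let w := (v.reindex (Equiv.subRight o)).isUnitSMul fun x => (hg x).isUnit
  have hw : ∀ x, w x = g x • v (x + o) := fun x => by
    simp [w, Module.Basis.isUnitSMul_apply]
  have hact := h.smul_shift hg hw
  rw [funext₂ fun x y => (hLI x y).1, funext₂ fun x y => (hLI x y).2] at hact
  exact Coeffs.nonempty_equiv hact

theorem exists_isStandard_nonempty_equiv (v : Module.Basis ℤ ℂ V)
    (hgr : ∀ m n : ℤ, ∀ x ∈ component m, ⁅x, v n⁆ ∈ Submodule.span ℂ {v (m + n)})
    (hind : Indecomposable V) : ∃ k, IsStandard k ∧ Nonempty (V ≃ₗ⁅ℂ,HV⁆ k.Mod) := by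
  obtain ⟨L, I, cL, cI, cLI, hact⟩ := exists_actsBy v hgr
  have hcon := hact.isConnected hind
  obtain ⟨hcL, hcI, hcLI, k, hk, hm⟩ := (hact.isStructureConstants hcon).exists_matches hcon
  obtain rfl : cL = 0 := funext fun x =>
    (hact.apply_eq_of_genBracket_eq_zero hcon hact.lie_CL (fun _ => rfl) x).trans hcL
  obtain rfl : cI = 0 := funext fun x =>
    (hact.apply_eq_of_genBracket_eq_zero hcon hact.lie_CI (fun _ => rfl) x).trans hcI
  obtain rfl : cLI = 0 := funext fun x =>
    (hact.apply_eq_of_genBracket_eq_zero hcon hact.lie_CLI (fun _ => rfl) x).trans hcLI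
  exact ⟨k, hk, hact.nonempty_equiv_of_matches hm⟩

end Module

theorem lie_gen_eq_zero_of_equiv {V : Type*} [AddCommGroup V] [Module ℂ V] [LieRingModule HV V]
    {k : Coeffs} (e : V ≃ₗ⁅ℂ,HV⁆ k.Mod) {g : Gen} (hg : k.genAct g = 0) (u : V) :
    ⁅gen g, u⁆ = 0 := by
  refine e.injective ?_
  have he : e ⁅gen g, u⁆ = ⁅gen g, e u⁆ := LieModuleHom.map_lie e.toLieModuleHom (gen g) u
  rw [he, k.lie_gen, hg, map_zero]
  rfl

end TwistedHV

theorem theorem3p5 {V : Type*} [AddCommGroup V] [Module ℂ V]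
    [LieRingModule TwistedHV.HV V] [LieModule ℂ TwistedHV.HV V]
    (v : Module.Basis ℤ ℂ V)
    (hgr : ∀ (m n : ℤ), ∀ x ∈ TwistedHV.component m, ⁅x, v n⁆ ∈ Submodule.span ℂ {v (m + n)})
    (hind : TwistedHV.Indecomposable V) :
    ((∃ a b c : ℂ, Nonempty (V ≃ₗ⁅ℂ, TwistedHV.HV⁆ (TwistedHV.modA a b c).Mod)) ∨
      (∃ a d : ℂ, Nonempty (V ≃ₗ⁅ℂ, TwistedHV.HV⁆ (TwistedHV.modAd a d).Mod)) ∨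
      (∃ a d : ℂ, Nonempty (V ≃ₗ⁅ℂ, TwistedHV.HV⁆ (TwistedHV.modB a d).Mod)) ∨
      (∃ d : ℂ, Nonempty (V ≃ₗ⁅ℂ, TwistedHV.HV⁆ (TwistedHV.modU d).Mod)) ∨
      (∃ d : ℂ, Nonempty (V ≃ₗ⁅ℂ, TwistedHV.HV⁆ (TwistedHV.modV d).Mod)) ∨
      (∃ d : ℂ, d ≠ 0 ∧ Nonempty (V ≃ₗ⁅ℂ, TwistedHV.HV⁆ (TwistedHV.modUtilde d).Mod)) ∨
      (∃ c : ℂ, c ≠ 0 ∧ Nonempty (V ≃ₗ⁅ℂ, TwistedHV.HV⁆ (TwistedHV.modVtilde c).Mod))) ∧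
    ∀ w : V, ⁅TwistedHV.gen .CL, w⁆ = 0 ∧ ⁅TwistedHV.gen .CI, w⁆ = 0 ∧
      ⁅TwistedHV.gen .CLI, w⁆ = 0 := by
  obtain ⟨k, hk, ⟨e⟩⟩ := TwistedHV.exists_isStandard_nonempty_equiv v hgr hind
  have central : ∀ {g}, k.genAct g = 0 → ∀ w : V, ⁅TwistedHV.gen g, w⁆ = 0 :=
    TwistedHV.lie_gen_eq_zero_of_equiv e
  refine ⟨?_, fun w => ⟨central rfl w, central rfl w, central rfl w⟩⟩
  cases hk with
  | modA a b c => exact .inl ⟨a, b, c, ⟨e⟩⟩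
  | modAd a d => exact .inr (.inl ⟨a, d, ⟨e⟩⟩)
  | modB a d => exact .inr (.inr (.inl ⟨a, d, ⟨e⟩⟩))
  | modU d => exact .inr (.inr (.inr (.inl ⟨d, ⟨e⟩⟩)))
  | modV d => exact .inr (.inr (.inr (.inr (.inl ⟨d, ⟨e⟩⟩))))
  | modUtilde hd => exact .inr (.inr (.inr (.inr (.inr (.inl ⟨_, hd, ⟨e⟩⟩)))))
  | modVtilde hc => exact .inr (.inr (.inr (.inr (.inr (.inr ⟨_, hc, ⟨e⟩⟩)))))
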